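/- There is an absolute constant $c>0$, and for every $\alpha>0$ a constant $C_\alpha>0$ depending only on $\alpha$, such that the following holds. Let $q$ be an arbitrary prime power and $n\ge 0$. Call a probability measure $\mu$ on $\mathbf F_q$ $\alpha$-balanced if $\mu(x+H)\le 1-\alpha$ for every $x\in\mathbf F_q$ and every proper subgroup $H$ of the additive group of $\mathbf F_q$ (including $H=\{0\}$). Let $M=(M_{ij})_{1\le i,j\le n}$ be a random $n\times n$ matrix over $\mathbf F_q$ with independent entries $M_{ij}\sim\mu_{ij}$, where each $\mu_{ij}$ is $\alpha$-balanced (the $\mu_{ij}$ need not be equal). For $0\le k\le n$ let $M_k$ be the submatrix formed by the first $k$ rows of $M$, and let $\operatorname{row} M_k\subseteq\mathbf F_q^n$ be the span of these rows. Then $$\left|\mathbf P(\dim \operatorname{row} M_k = k)-\prod_{i=n-k+1}^{\infty}\bigl(1-q^{-i}\bigr)\right|\le C_\alpha\, e^{-c\alpha n}.$$ -/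

import Mathlib

open MeasureTheory ProbabilityTheory
open scoped Pointwise

/-- A (probability) measure `μ` on the finite field `F` is `α`-balanced if every translate of every
proper additive subgroup (the trivial one included) has mass at most `1 - α`. -/
def IsBalanced {F : Type*} [Field F] [MeasurableSpace F] (α : ℝ) (μ : Measure F) : Prop :=
  ∀ (x : F) (H : AddSubgroup F), H ≠ ⊤ → μ.real (x +ᵥ (H : Set F)) ≤ 1 - α

/-- The top `k × n` submatrix of an `n × n` matrix. -/
def topRows {F : Type*} {n k : ℕ} (hk : k ≤ n) (M : Matrix (Fin n) (Fin n) F) :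
    Matrix (Fin k) (Fin n) F :=
  M.submatrix (Fin.castLE hk) id

/-- The row space of a `k × n` matrix, a subspace of `F ^ n`. -/
def rowSpace {F : Type*} [Field F] {n k : ℕ} (A : Matrix (Fin k) (Fin n) F) :
    Submodule F (Fin n → F) :=
  Submodule.span F (Set.range A.row)

/-- The infinite product `∏_{i ≥ m} (1 - q ^ (-i))` converges, so that its `∏'` is not a default
value. -/
theorem multipliable_one_sub_inv_pow {q : ℕ} (hq : 2 ≤ q) (m : ℕ) :
    Multipliable fun i : ℕ => (1 : ℝ) - ((q : ℝ) ^ (m + i))⁻¹ := by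
  have h2 : (2 : ℝ) ≤ q := by exact_mod_cast hq
  have h1 : (q : ℝ)⁻¹ < 1 := inv_lt_one_of_one_lt₀ (by linarith)
  have hs : Summable fun i : ℕ => -((q : ℝ) ^ (m + i))⁻¹ := by
    have h := (summable_geometric_of_lt_one (by positivity) h1).mul_left (((q : ℝ)⁻¹) ^ m)
    simpa [pow_add, mul_comm] using h.neg
  simpa [sub_eq_add_neg] using multipliable_one_add_of_summable hs.norm

/-! Expose the rows one at a time. If the first `k` rows are independent with span `V` and the next
row were uniform, it would lie in `V` with probability `q^{-(n-k)}`. Multiplying the complementary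
probabilities gives the product of `1 - q^{-i}` over `n-k < i ≤ n`, and the missing tail of the
infinite product costs at most `2^{-n}`. The errors of the single steps add up
(`abs_indepProb_sub_prod_le`), so the task is to bound the expected error `spanError` of one step by
a power of `n` times `exp(-αn/2^80)`, uniformly in `q` (`spanError_le_pow_mul_exp`).

If `V` has codimension at least `n/200`, both probabilities are exponentially small
(`pr_mem_submodule_le`). Otherwise Fourier inversion on `V` turns the error into an average of
products of Fourier coefficients over the nonzero `w` orthogonal to all rows. Averaging over scalar
multiples of `w` replaces each product by `rho w`, which also bounds `|P(x ⬝ᵥ w = 0) - 1/q|`. The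
kernel vectors `w` are of four kinds. Sparse: a union bound over supports shows that such kernel
vectors rarely exist. Negligible, `rho w ≤ ε` for the new row: the average contributes at most `ε`.
Unstructured, `rho w ≤ 1/(10q)` for all exposed rows but not negligible: each is in the kernel with
probability at most `(1.1/q)^k`, and a high moment of `rho` shows that there are few of them.
Structured: `n/4` of the rows are swapped for copies of a lazy difference walk, for which `x ⬝ᵥ w =
0` is far more likely. The swapped rows still have a kernel of size `q^{n-k}`, so the expected
number of structured kernel vectors gains a factor exponentially small in `n`
(`sum_pr_structured_le`).

The comparison with the lazy walk (`two_pow_mul_rho_le`) is a Halász-type argument. Let `D t` be the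
total defect of the Fourier coefficients at `t • w`. The balance condition makes `D` large somewhere
on each nontrivial subgroup, which forces the sublevel sets of `D` to grow geometrically. -/

section

open scoped Classical
open Finset

/-- A probability weight on a finite type. -/
structure IsProb {Ω : Type*} [Fintype Ω] (w : Ω → ℝ) : Prop where
  nonneg : ∀ a, 0 ≤ w a
  sum_eq : ∑ a, w a = 1

/-- The mass of an event under a weight on a finite type. -/
noncomputable def pr {Ω : Type*} [Fintype Ω] (w : Ω → ℝ) (S : Ω → Prop) : ℝ :=
  ∑ a, w a * if S a then 1 else 0

/-- The product weight on a finite power. -/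
def prodWeight {ι E : Type*} [Fintype ι] (p : ι → E → ℝ) (A : ι → E) : ℝ :=
  ∏ i, p i (A i)

/-! ### Product weights on finite sets: union bounds and conditioning on a set of coordinates. -/

section Basics

variable {Ω Ω' : Type*} [Fintype Ω] [Fintype Ω'] {w : Ω → ℝ} {S T : Ω → Prop}

theorem pr_nonneg (hw : ∀ a, 0 ≤ w a) : 0 ≤ pr w S :=
  sum_nonneg fun a _ => mul_nonneg (hw a) (by split_ifs <;> norm_num)

theorem pr_mono (hw : ∀ a, 0 ≤ w a) (h : ∀ a, S a → T a) : pr w S ≤ pr w T := by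
  refine sum_le_sum fun a _ => mul_le_mul_of_nonneg_left ?_ (hw a)
  by_cases hS : S a
  · simp [hS, h a hS]
  · simp only [hS, if_false]; split_ifs <;> norm_num

theorem pr_true (hw : IsProb w) : pr w (fun _ => True) = 1 := by
  simp [pr, hw.sum_eq]

theorem pr_le_one (hw : IsProb w) : pr w S ≤ 1 :=
  (pr_mono hw.nonneg fun _ _ => trivial).trans_eq (pr_true hw)

theorem pr_congr (h : ∀ a, S a ↔ T a) : pr w S = pr w T := by
  simp [pr, h]

theorem pr_exists_le {κ : Type*} (hw : ∀ a, 0 ≤ w a) (s : Finset κ) (Q : κ → Ω → Prop) :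
    pr w (fun a => ∃ k ∈ s, Q k a) ≤ ∑ k ∈ s, pr w (Q k) := by
  unfold pr
  rw [sum_comm]
  refine sum_le_sum fun a _ => ?_
  rw [← mul_sum]
  refine mul_le_mul_of_nonneg_left ?_ (hw a)
  split_ifs with h
  · obtain ⟨k, hk, hQ⟩ := h
    have := single_le_sum (f := fun k => if Q k a then (1 : ℝ) else 0)
      (fun _ _ => by split_ifs <;> norm_num) hk
    simpa [hQ] using this
  · exact sum_nonneg fun _ _ => by split_ifs <;> norm_num

theorem pr_sub_le (hw : ∀ a, 0 ≤ w a) :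
    pr w S - pr w T ≤ pr w (fun a => S a ∧ ¬ T a) := by
  rw [sub_le_iff_le_add]
  unfold pr
  rw [← sum_add_distrib]
  refine sum_le_sum fun a _ => ?_
  rw [← mul_add]
  refine mul_le_mul_of_nonneg_left ?_ (hw a)
  by_cases hS : S a <;> by_cases hT : T a <;> simp [hS, hT]

theorem sum_fiber_mul_eq_pr {w : Ω → ℝ} (S : Ω → Prop) :
    pr w S = ∑ a with S a, w a := by
  simp [pr, sum_filter]

theorem isProb_prodWeight {ι E : Type*} [Fintype ι] [DecidableEq ι] [Fintype E] {p : ι → E → ℝ}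
    (hp : ∀ i, IsProb (p i)) : IsProb (prodWeight p) where
  nonneg A := prod_nonneg fun i _ => (hp i).nonneg _
  sum_eq := by
    unfold prodWeight
    rw [← Fintype.piFinset_univ, ← prod_univ_sum]
    simp [(hp _).sum_eq]

theorem sum_prodWeight_mul {ι E R : Type*} [Fintype ι] [DecidableEq ι] [Fintype E] [CommSemiring R]
    (f : ι → E → R) : ∑ A : ι → E, ∏ i, f i (A i) = ∏ i, ∑ e, f i e := by
  rw [prod_univ_sum, Fintype.piFinset_univ]

theorem pr_forall {ι E : Type*} [Fintype ι] [DecidableEq ι] [Fintype E] (p : ι → E → ℝ) (S : ι → E → Prop) :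
    pr (prodWeight p) (fun A => ∀ i, S i (A i)) = ∏ i, pr (p i) (S i) := by
  unfold pr
  rw [← sum_prodWeight_mul]
  refine sum_congr rfl fun A _ => ?_
  rw [prod_mul_distrib, prodWeight]
  congr 1
  rw [prod_ite_zero]
  simp

/-- Splitting the coordinates of a product weight in two groups. -/
theorem sum_prodWeight_split {ι E : Type*} [Fintype ι] [DecidableEq ι] [Fintype E] (p : ι → E → ℝ)
    (B : Finset ι) (f : ({i // i ∈ B} → E) → ({i // i ∉ B} → E) → ℝ) :
    ∑ A : ι → E, prodWeight p A * f (fun i => A i) (fun i => A i) =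
      ∑ a : {i // i ∈ B} → E, ∑ b : {i // i ∉ B} → E,
        prodWeight (fun i : {i // i ∈ B} => p i) a * prodWeight (fun i : {i // i ∉ B} => p i) b *
          f a b := by
  rw [← Fintype.sum_prod_type']
  refine Fintype.sum_equiv (Equiv.piEquivPiSubtypeProd (· ∈ B) fun _ => E) _ _ fun A => ?_
  simp only [Equiv.piEquivPiSubtypeProd_apply, prodWeight]
  congr 1
  convert (Fintype.prod_subtype_mul_prod_subtype (· ∈ B) fun i => p i (A i)).symm

/-- If, given the coordinates in `B`, every other coordinate lies in an event of mass at most `c`,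
then the total mass is at most a power of `c` times the mass of an event about `B`. -/
theorem pr_and_forall_notMem_le {ι E : Type*} [Fintype ι] [DecidableEq ι] [Fintype E]
    {p : ι → E → ℝ} (hp : ∀ i, IsProb (p i)) (B : Finset ι) (G : ({i // i ∈ B} → E) → Prop)
    (Q : ({i // i ∈ B} → E) → E → Prop) {c : ℝ} (h : ∀ a i, pr (p i) (Q a) ≤ c) :
    pr (prodWeight p) (fun A => G (fun j => A j) ∧ ∀ i, i ∉ B → Q (fun j => A j) (A i)) ≤
      pr (prodWeight fun i : {i // i ∈ B} => p i) G * c ^ (Fintype.card ι - #B) := by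
  have h1 := sum_prodWeight_split p B
    (fun a b => (if G a then 1 else 0) * if ∀ i : {i // i ∉ B}, Q a (b i) then 1 else 0)
  have h2 : pr (prodWeight p)
      (fun A => G (fun j => A j) ∧ ∀ i, i ∉ B → Q (fun j => A j) (A i)) =
      ∑ A : ι → E, prodWeight p A * ((if G fun i => A i then 1 else 0) *
        if ∀ i : {i // i ∉ B}, Q (fun i => A i) (A i) then 1 else 0) := by
    simp only [pr, ite_zero_mul_ite_zero, mul_one, Subtype.forall]
    congr!
  rw [h2, h1, pr, sum_mul]
  refine sum_le_sum fun a _ => ?_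
  have h4 : ∑ b : {i // i ∉ B} → E, prodWeight (fun i : {i // i ∉ B} => p i) b *
      (if ∀ i : {i // i ∉ B}, Q a (b i) then 1 else 0) =
        ∏ i : {i // i ∉ B}, pr (p i) (Q a) := by
    rw [← pr_forall (fun i : {i // i ∉ B} => p i) (fun _ => Q a), pr]
    congr!
  have h5 : ∏ i : {i // i ∉ B}, pr (p i) (Q a) ≤ c ^ (Fintype.card ι - #B) := by
    refine (prod_le_prod (fun i _ => pr_nonneg (hp i.1).nonneg) fun i _ => h a i.1).trans_eq ?_
    rw [prod_const, card_univ, Fintype.card_subtype_compl, Fintype.card_coe]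
  rw [← h4] at h5
  refine le_trans (le_of_eq ?_) (mul_le_mul_of_nonneg_left h5 (mul_nonneg
    ((isProb_prodWeight fun i : {i // i ∈ B} => hp i).nonneg a)
    (by split_ifs <;> norm_num : (0 : ℝ) ≤ if G a then 1 else 0)))
  rw [mul_sum]
  exact sum_congr rfl fun b _ => by ring

theorem pr_forall_notMem_le {ι E : Type*} [Fintype ι] [DecidableEq ι] [Fintype E]
    {p : ι → E → ℝ} (hp : ∀ i, IsProb (p i)) (B : Finset ι) (Q : ({i // i ∈ B} → E) → E → Prop)
    {c : ℝ} (h : ∀ a i, pr (p i) (Q a) ≤ c) :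
    pr (prodWeight p) (fun A => ∀ i, i ∉ B → Q (fun j => A j) (A i)) ≤
      c ^ (Fintype.card ι - #B) := by
  have h1 := pr_and_forall_notMem_le hp B (fun _ => True) Q h
  rw [pr_true (isProb_prodWeight fun i : {i // i ∈ B} => hp i), one_mul] at h1
  simpa using h1

end Basics

end

/-! ### Growth of sublevel sets and comparison of sums by layers. -/

section

open scoped Classical
open Finset

section Growth

variable {G : Type*} [AddCommGroup G] [Fintype G] {D : G → ℝ} {a : ℝ}

/-- Let `T = {D ≤ u}`. If `T + T + T` were inside `T + T`, then `T + T` would be a nontrivial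
subgroup on which `D ≤ 4u < a`. So some `x + t + s` lies outside `T + T`, and by the symmetry of `T`
its translate of `T` is disjoint from `T`. Two applications of `hadd` put both sets inside `{D ≤
16u}`. Excluding `0` keeps the factor `2`, since `2(N + 1) ≤ N' + 1`. -/
theorem two_mul_card_sublevel_le (h0 : D 0 = 0) (hneg : ∀ t, D (-t) = D t)
    (hadd : ∀ s t, D (s + t) ≤ 2 * D s + 2 * D t)
    (hH : ∀ H : AddSubgroup G, H ≠ ⊥ → ∃ t ∈ H, a ≤ D t) {u : ℝ} (hu0 : 0 ≤ u)
    (hu : 16 * u < a) :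
    2 * #{t | t ≠ 0 ∧ D t ≤ u} ≤ #{t | t ≠ 0 ∧ D t ≤ 16 * u} := by
  by_cases hT : ∀ t, D t ≤ u → t = 0
  · have : #{t | t ≠ 0 ∧ D t ≤ u} = 0 := by
      rw [card_eq_zero, filter_eq_empty_iff]
      rintro t - ⟨h1, h2⟩
      exact h1 (hT t h2)
    omega
  push Not at hT
  obtain ⟨t₀, ht₀, ht₀'⟩ := hT
  obtain ⟨x, t, s, hx, ht, hs, hxt⟩ : ∃ x t s, D x ≤ u ∧ D t ≤ u ∧ D s ≤ u ∧
      ∀ y z, D y ≤ u → D z ≤ u → x + t + s ≠ y + z := by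
    by_contra! hcon
    let H : AddSubgroup G :=
      { carrier := {x | ∃ y z, D y ≤ u ∧ D z ≤ u ∧ x = y + z}
        zero_mem' := ⟨0, 0, by simp [h0, hu0], by simp [h0, hu0], by simp⟩
        add_mem' := by
          rintro _ _ ⟨y, z, hy, hz, rfl⟩ ⟨y', z', hy', hz', rfl⟩
          obtain ⟨y₁, z₁, hy₁, hz₁, h₁⟩ := hcon y z y' hy hz hy'
          obtain ⟨y₂, z₂, hy₂, hz₂, h₂⟩ := hcon y₁ z₁ z' hy₁ hz₁ hz'
          exact ⟨y₂, z₂, hy₂, hz₂, by rw [← h₂, ← h₁]; abel⟩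
        neg_mem' := by
          rintro _ ⟨y, z, hy, hz, rfl⟩
          exact ⟨-y, -z, by rwa [hneg], by rwa [hneg], by abel⟩ }
    have hHbot : H ≠ ⊥ := by
      intro h
      have : t₀ ∈ H := ⟨t₀, 0, ht₀, by simp [h0, hu0], by simp⟩
      rw [h] at this
      exact ht₀' this
    obtain ⟨_, ⟨y, z, hy, hz, rfl⟩, hyz⟩ := hH H hHbot
    linarith [hadd y z]
  set T : Finset G := {r | D r ≤ u} with hTdef
  have hc : #T = #{r | r ≠ 0 ∧ D r ≤ u} + 1 := by
    have : T = insert 0 (univ.filter fun r => r ≠ 0 ∧ D r ≤ u) := by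
      ext r
      by_cases hr : r = 0
      · simp [hTdef, hr, h0, hu0]
      · simp [hTdef, hr]
    rw [this, card_insert_of_notMem (by simp)]
  have hc' : #{r | D r ≤ 16 * u} = #{r | r ≠ 0 ∧ D r ≤ 16 * u} + 1 := by
    have : (univ.filter fun r => D r ≤ 16 * u) =
        insert 0 (univ.filter fun r => r ≠ 0 ∧ D r ≤ 16 * u) := by
      ext r
      by_cases hr : r = 0
      · simp [hr, h0, hu0]
      · simp [hr]
    rw [this, card_insert_of_notMem (by simp)]
  have hdisj : Disjoint T (T.image fun r => x + t + s + r) := by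
    rw [Finset.disjoint_left]
    intro r hr hr'
    obtain ⟨r', hr₁, rfl⟩ := mem_image.1 hr'
    have hr1 : D (x + t + s + r') ≤ u := by simpa [hTdef] using hr
    have hr2 : D r' ≤ u := (mem_filter.1 hr₁).2
    exact hxt (x + t + s + r') (-r') hr1 (by rwa [hneg]) (by abel)
  have hsub : T ∪ (T.image fun r => x + t + s + r) ⊆ univ.filter fun r => D r ≤ 16 * u := by
    intro r hr
    rw [mem_filter]
    refine ⟨mem_univ _, ?_⟩
    rcases mem_union.1 hr with hr | hr
    · have : D r ≤ u := by simpa [hTdef] using hr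
      linarith
    · obtain ⟨r', hr', rfl⟩ := mem_image.1 hr
      have : D r' ≤ u := by simpa [hTdef] using hr'
      rw [add_assoc (x + t)]
      linarith [hadd (x + t) (s + r'), hadd x t, hadd s r']
  have := card_le_card hsub
  rw [card_union_of_disjoint hdisj, card_image_of_injective _ (add_right_injective _), hc,
    hc'] at this
  omega

theorem two_pow_mul_card_sublevel_le (h0 : D 0 = 0) (hneg : ∀ t, D (-t) = D t)
    (hadd : ∀ s t, D (s + t) ≤ 2 * D s + 2 * D t)
    (hH : ∀ H : AddSubgroup G, H ≠ ⊥ → ∃ t ∈ H, a ≤ D t) {u : ℝ} (hu0 : 0 ≤ u) (K : ℕ)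
    (hu : 16 ^ K * u < a) :
    2 ^ K * #{t | t ≠ 0 ∧ D t ≤ u} ≤ #{t | t ≠ 0 ∧ D t ≤ 16 ^ K * u} := by
  induction K with
  | zero => simp
  | succ K ih =>
    have h1 : (16 : ℝ) ^ K * u ≤ 16 ^ (K + 1) * u := by
      rw [pow_succ]; nlinarith [show (0 : ℝ) ≤ 16 ^ K * u by positivity]
    have h2 := two_mul_card_sublevel_le h0 hneg hadd hH (u := 16 ^ K * u) (by positivity)
      (by rw [← mul_assoc, ← pow_succ']; exact hu)
    rw [← mul_assoc, ← pow_succ'] at h2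
    have := ih (h1.trans_lt hu)
    calc 2 ^ (K + 1) * #{t | t ≠ 0 ∧ D t ≤ u} = 2 * (2 ^ K * #{t | t ≠ 0 ∧ D t ≤ u}) := by ring
      _ ≤ _ := by omega

end Growth

/-- Comparison of two finite sums through their superlevel sets. -/
theorem mul_sum_le_of_card_superlevel_le {T : Type*} (s : Finset T) {f g : T → ℝ} {m l : ℝ}
    (hm : 0 ≤ m) (hl : 0 ≤ l) (hf1 : ∀ t ∈ s, f t ≤ 1) (hg0 : ∀ t ∈ s, 0 ≤ g t)
    (h : ∀ x, l < x → x < 1 → m * #{t ∈ s | x < f t} ≤ #{t ∈ s | x ≤ g t}) :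
    m * ∑ t ∈ s, f t ≤ ∑ t ∈ s, g t + m * (#s * l) := by
  have hint : ∀ S : Set ℝ, MeasurableSet S →
      IntegrableOn (S.indicator fun _ => (1 : ℝ)) (Set.Ioo l 1) volume := fun S hS =>
    (integrable_const (1 : ℝ)).indicator hS
  have hval : ∀ S : Set ℝ, MeasurableSet S →
      ∫ x in Set.Ioo l 1, S.indicator (fun _ => (1 : ℝ)) x = volume.real (S ∩ Set.Ioo l 1) := by
    intro S hS
    rw [integral_indicator_const _ hS, measureReal_restrict_apply hS, smul_eq_mul, mul_one]
  -- Layer cake: the counting hypothesis is integrated over `x` in `(l, 1)`. The levels below `l`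
  -- cost at most `l` per point, whence the term `m * (#s * l)`.
  have key : m * ∑ t ∈ s, volume.real (Set.Iio (f t) ∩ Set.Ioo l 1) ≤
      ∑ t ∈ s, volume.real (Set.Iic (g t) ∩ Set.Ioo l 1) := by
    simp_rw [← hval _ measurableSet_Iio, ← hval _ measurableSet_Iic]
    rw [← integral_finsetSum _ fun t _ => hint _ measurableSet_Iio,
      ← integral_finsetSum _ fun t _ => hint _ measurableSet_Iic, ← integral_const_mul]
    refine setIntegral_mono_on ?_ ?_ measurableSet_Ioo fun x hx => ?_
    · exact (integrable_finsetSum _ fun t _ => hint _ measurableSet_Iio).const_mul _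
    · exact integrable_finsetSum _ fun t _ => hint _ measurableSet_Iic
    · have := h x hx.1 hx.2
      simpa only [Set.indicator_apply, card_filter, Set.mem_Iio, Set.mem_Iic, Nat.cast_sum,
        Nat.cast_ite, Nat.cast_one, Nat.cast_zero] using this
  have h1 : ∑ t ∈ s, (f t - l) ≤ ∑ t ∈ s, volume.real (Set.Iio (f t) ∩ Set.Ioo l 1) := by
    refine sum_le_sum fun t ht => ?_
    have : volume.real (Set.Ioo l (f t)) ≤ volume.real (Set.Iio (f t) ∩ Set.Ioo l 1) := by
      refine measureReal_mono (fun x hx => ⟨hx.2, hx.1, hx.2.trans_le (hf1 t ht)⟩) ?_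
      exact ((measure_mono Set.inter_subset_right).trans_lt measure_Ioo_lt_top).ne
    refine le_trans ?_ this
    rw [Real.volume_real_Ioo]
    exact le_max_left _ _
  have h2 : ∑ t ∈ s, volume.real (Set.Iic (g t) ∩ Set.Ioo l 1) ≤ ∑ t ∈ s, g t := by
    refine sum_le_sum fun t ht => ?_
    have : volume.real (Set.Iic (g t) ∩ Set.Ioo l 1) ≤ volume.real (Set.Icc 0 (g t)) :=
      measureReal_mono (fun x hx => ⟨hl.trans hx.2.1.le, hx.1⟩) measure_Icc_lt_top.ne
    refine this.trans_eq ?_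
    rw [Real.volume_real_Icc_of_le (hg0 t ht), sub_zero]
  rw [sum_sub_distrib, sum_const, nsmul_eq_mul] at h1
  nlinarith [mul_le_mul_of_nonneg_left h1 hm]

end

/-! ### Fourier transform of a single entry: the defect and the lazy difference walk. -/

section

open scoped Classical
open Finset

variable {F : Type*} [Field F] [Fintype F]

/-- A weight on the field `F` giving mass at most `1 - α` to each coset of each proper additive
subgroup. -/
def BalancedWeight (α : ℝ) (p : F → ℝ) : Prop :=
  ∀ (x : F) (H : AddSubgroup F), H ≠ ⊤ → pr p (fun y => y - x ∈ H) ≤ 1 - α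

/-- The Fourier transform of a weight on `F`. -/
noncomputable def ft (ψ : AddChar F ℂ) (p : F → ℝ) (t : F) : ℂ :=
  ∑ x, (p x : ℂ) * ψ (t * x)

/-- The defect from `1` of the squared modulus of the Fourier transform. -/
noncomputable def defect (ψ : AddChar F ℂ) (p : F → ℝ) (t : F) : ℝ :=
  1 - ‖ft ψ p t‖ ^ 2

/-- With probability `β` the difference of two independent copies, and `0` otherwise. -/
noncomputable def lazyDiff (β : ℝ) (p : F → ℝ) (z : F) : ℝ :=
  (1 - β) * (if z = 0 then 1 else 0) + β * ∑ y, p y * p (y + z)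

section OneCoordinate

variable {ψ : AddChar F ℂ} {p : F → ℝ} {α β : ℝ}

theorem ft_zero (hp : IsProb p) : ft ψ p 0 = 1 := by
  simp [ft, ← Complex.ofReal_sum, hp.sum_eq]

theorem norm_ft_le_one (hp : IsProb p) (t : F) : ‖ft ψ p t‖ ≤ 1 := by
  refine (norm_sum_le _ _).trans_eq ?_
  rw [← hp.sum_eq]
  refine sum_congr rfl fun x _ => ?_
  rw [norm_mul, AddChar.norm_apply, mul_one, Complex.norm_real, Real.norm_of_nonneg (hp.nonneg x)]

theorem norm_sq_ft (t : F) :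
    ((‖ft ψ p t‖ ^ 2 : ℝ) : ℂ) = ∑ x, ∑ y, (p x : ℂ) * p y * ψ (t * (x - y)) := by
  push_cast
  rw [← Complex.mul_conj', ft, map_sum, sum_mul_sum]
  refine sum_congr rfl fun x _ => sum_congr rfl fun y _ => ?_
  rw [map_mul (starRingEnd ℂ), Complex.conj_ofReal, ← AddChar.map_neg_eq_conj, mul_sub, sub_eq_add_neg,
    AddChar.map_add_eq_mul]
  ring

theorem sum_sum_weight {E : Type*} [Fintype E] {p : E → ℝ} (hp : IsProb p) : ∑ x, ∑ y, p x * p y = 1 := by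
  rw [← sum_mul_sum, hp.sum_eq, one_mul]

theorem defect_eq_re (hp : IsProb p) (t : F) :
    defect ψ p t = ∑ x, ∑ y, p x * p y * (1 - (ψ (t * (x - y))).re) := by
  have h := congrArg Complex.re (norm_sq_ft (ψ := ψ) (p := p) t)
  rw [Complex.ofReal_re] at h
  rw [defect, h]
  simp_rw [mul_sub, mul_one, sum_sub_distrib, sum_sum_weight hp]
  simp [Complex.re_sum, ← Complex.ofReal_mul]

theorem norm_one_sub_sq {z : ℂ} (hz : ‖z‖ = 1) : ‖1 - z‖ ^ 2 = 2 * (1 - z.re) := by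
  have h : z.re * z.re + z.im * z.im = 1 := by
    rw [← Complex.normSq_apply, Complex.normSq_eq_norm_sq, hz, one_pow]
  rw [← Complex.normSq_eq_norm_sq, Complex.normSq_apply]
  simp only [Complex.sub_re, Complex.one_re, Complex.sub_im, Complex.one_im]
  nlinarith

theorem defect_eq (hp : IsProb p) (t : F) :
    defect ψ p t = ∑ x, ∑ y, p x * p y * (‖1 - ψ (t * (x - y))‖ ^ 2 / 2) := by
  rw [defect_eq_re hp]
  refine sum_congr rfl fun x _ => sum_congr rfl fun y _ => ?_
  rw [norm_one_sub_sq (AddChar.norm_apply _ _)]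
  ring

theorem defect_nonneg (hp : IsProb p) (t : F) : 0 ≤ defect ψ p t := by
  have := norm_ft_le_one (ψ := ψ) hp t
  have := norm_nonneg (ft ψ p t)
  unfold defect
  nlinarith

theorem defect_le_one (t : F) : defect ψ p t ≤ 1 := by
  unfold defect
  nlinarith [norm_nonneg (ft ψ p t)]

theorem defect_zero (hp : IsProb p) : defect ψ p 0 = 0 := by
  simp [defect, ft_zero hp]

theorem defect_neg (hp : IsProb p) (t : F) : defect ψ p (-t) = defect ψ p t := by
  rw [defect_eq_re hp, defect_eq_re hp]
  simp [neg_mul, AddChar.map_neg_eq_conj]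

/-- The defect averages `‖1 - χ‖² / 2` over character values `χ`; the distance to `1` is subadditive
on unimodular numbers, and squaring costs a factor `2`. -/
theorem defect_add_le (hp : IsProb p) (s t : F) :
    defect ψ p (s + t) ≤ 2 * defect ψ p s + 2 * defect ψ p t := by
  simp_rw [defect_eq hp, mul_sum, ← sum_add_distrib]
  refine sum_le_sum fun x _ => sum_le_sum fun y _ => ?_
  have key : ‖1 - ψ ((s + t) * (x - y))‖ ^ 2 ≤
      2 * ‖1 - ψ (s * (x - y))‖ ^ 2 + 2 * ‖1 - ψ (t * (x - y))‖ ^ 2 := by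
    have h : ‖1 - ψ ((s + t) * (x - y))‖ ≤ ‖1 - ψ (s * (x - y))‖ + ‖1 - ψ (t * (x - y))‖ := by
      have : 1 - ψ ((s + t) * (x - y)) =
          (1 - ψ (s * (x - y))) + ψ (s * (x - y)) * (1 - ψ (t * (x - y))) := by
        rw [add_mul, AddChar.map_add_eq_mul]; ring
      rw [this]
      refine (norm_add_le _ _).trans_eq ?_
      rw [norm_mul, AddChar.norm_apply, one_mul]
    have h0 := norm_nonneg (1 - ψ ((s + t) * (x - y)))
    nlinarith [sq_nonneg (‖1 - ψ (s * (x - y))‖ - ‖1 - ψ (t * (x - y))‖)]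
  have := mul_le_mul_of_nonneg_left key (mul_nonneg (hp.nonneg x) (hp.nonneg y))
  linarith

theorem norm_ft_le_exp (t : F) :
    ‖ft ψ p t‖ ≤ Real.exp (-(defect ψ p t) / 2) := by
  have h : ‖ft ψ p t‖ ^ 2 ≤ Real.exp (-(defect ψ p t) / 2) ^ 2 := by
    rw [← Real.exp_nat_mul]
    have := Real.add_one_le_exp (-(defect ψ p t))
    have h2 : ‖ft ψ p t‖ ^ 2 = 1 - defect ψ p t := by rw [defect]; ring
    have h3 : ((2 : ℕ) : ℝ) * (-(defect ψ p t) / 2) = -(defect ψ p t) := by push_cast; ring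
    rw [h2, h3]
    linarith
  exact (sq_le_sq₀ (norm_nonneg _) (Real.exp_nonneg _)).1 h

theorem exp_neg_two_mul_le {x : ℝ} (h0 : 0 ≤ x) (h1 : x ≤ 1 / 2) :
    Real.exp (-(2 * x)) ≤ 1 - x := by
  have h := Real.add_one_le_exp (2 * x)
  have h2 : 1 ≤ (1 - x) * Real.exp (2 * x) := by nlinarith
  rw [Real.exp_neg, inv_le_iff_one_le_mul₀ (Real.exp_pos _)]
  exact h2

/-- On every nontrivial subgroup, the defect of a balanced weight is on average at least `α`. -/
theorem card_mul_le_sum_defect (hψ : ψ.IsPrimitive) (hp : IsProb p) (hα : BalancedWeight α p)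
    {w : F} (hw : w ≠ 0) (H : AddSubgroup F) (hH : H ≠ ⊥) :
    Fintype.card H * α ≤ ∑ t : H, defect ψ p (t * w) := by
  -- `K` is the annihilator of `H • w`. Orthogonality of characters makes the sum over `H` of `1 -
  -- Re ψ` equal to `#H` off `K` and `0` on `K`; primitivity makes `K` proper, so for fixed `y`
  -- balance gives `x - y ∉ K` mass at least `α`.
  let K : AddSubgroup F :=
    { carrier := {z | ∀ t ∈ H, ψ (t * w * z) = 1}
      zero_mem' := by simp
      add_mem' := fun {a b} ha hb t ht => by
        rw [mul_add, AddChar.map_add_eq_mul, ha t ht, hb t ht, one_mul]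
      neg_mem' := fun {a} ha t ht => by
        rw [mul_neg, AddChar.map_neg_eq_conj, ha t ht, map_one] }
  have hK : K ≠ ⊤ := by
    intro h
    obtain ⟨⟨t, ht⟩, ht0⟩ := (AddSubgroup.ne_bot_iff_exists_ne_zero (H := H)).1 hH
    replace ht0 : t ≠ 0 := fun h0 => ht0 (Subtype.ext h0)
    refine hψ (mul_ne_zero ht0 hw) ?_
    ext z
    have : z ∈ K := h ▸ AddSubgroup.mem_top z
    simpa [AddChar.mulShift_apply] using this _ ht
  have hsum : ∀ z, z ∉ K → ∑ t : H, (ψ (t * w * z)).re = 0 := by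
    intro z hz
    let χ : AddChar H ℂ := (ψ.mulShift (w * z)).compAddMonoidHom H.subtype
    have hχ : χ ≠ 1 := by
      intro h
      refine hz fun t ht => ?_
      have := DFunLike.congr_fun h ⟨t, ht⟩
      simpa [χ, AddChar.mulShift_apply, mul_comm, mul_left_comm, mul_assoc] using this
    have h := congrArg Complex.re (AddChar.sum_eq_zero_of_ne_one hχ)
    rw [Complex.re_sum, Complex.zero_re] at h
    rw [← h]
    refine sum_congr rfl fun t _ => ?_
    simp [χ, AddChar.mulShift_apply, mul_comm, mul_left_comm]
  have hle : ∀ z, ∑ t : H, (1 - (ψ (t * w * z)).re) ≥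
      Fintype.card H * (1 - if z ∈ K then 1 else 0) := by
    intro z
    split_ifs with hz
    · rw [sub_self, mul_zero]
      refine sum_nonneg fun t _ => ?_
      rw [hz t t.2]
      simp
    · rw [sum_sub_distrib, hsum z hz]
      simp
  have h1 : ∑ t : H, defect ψ p (t * w) =
      ∑ y, ∑ x, p y * p x * ∑ t : H, (1 - (ψ (t * w * (x - y))).re) := by
    simp_rw [defect_eq_re hp, mul_sum]
    rw [sum_comm]
    simp_rw [sum_comm (s := (univ : Finset H))]
    rw [sum_comm]
    exact sum_congr rfl fun _ _ => sum_congr rfl fun _ _ => sum_congr rfl fun _ _ => by ring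
  rw [h1]
  have h2 : ∀ y, p y * (Fintype.card H * α) ≤
      ∑ x, p y * p x * ∑ t : H, (1 - (ψ (t * w * (x - y))).re) := by
    intro y
    have h3 : ∑ x, p y * p x * (Fintype.card H * (1 - if x - y ∈ K then 1 else 0)) ≤
        ∑ x, p y * p x * ∑ t : H, (1 - (ψ (t * w * (x - y))).re) :=
      sum_le_sum fun x _ =>
        mul_le_mul_of_nonneg_left (hle _) (mul_nonneg (hp.nonneg y) (hp.nonneg x))
    refine le_trans ?_ h3
    have h4 : ∑ x, p y * p x * (Fintype.card H * (1 - if x - y ∈ K then (1 : ℝ) else 0)) =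
        p y * (Fintype.card H * (∑ x, p x - pr p (fun x => x - y ∈ K))) := by
      rw [pr, ← sum_sub_distrib, mul_sum, mul_sum]
      exact sum_congr rfl fun _ _ => by ring
    rw [h4, hp.sum_eq]
    refine mul_le_mul_of_nonneg_left ?_ (hp.nonneg y)
    refine mul_le_mul_of_nonneg_left ?_ (Nat.cast_nonneg _)
    linarith [hα y K hK]
  refine le_trans ?_ (sum_le_sum fun y _ => h2 y)
  rw [← sum_mul, hp.sum_eq, one_mul]

theorem BalancedWeight.le_one_sub (hα : BalancedWeight α p) (x : F) : p x ≤ 1 - α := by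
  have h := hα x ⊥ (bot_ne_top)
  have h1 : pr p (fun y => y - x ∈ (⊥ : AddSubgroup F)) = p x := by
    simp [pr, sub_eq_zero]
  rwa [h1] at h

theorem BalancedWeight.le_one (hp : IsProb p) (hα : BalancedWeight α p) : α ≤ 1 := by
  linarith [hα.le_one_sub 0, hp.nonneg 0]

theorem sum_corr (hp : IsProb p) : ∑ z, ∑ y, p y * p (y + z) = 1 := by
  rw [sum_comm]
  simp_rw [← mul_sum]
  have : ∀ y, ∑ z, p (y + z) = 1 := fun y => by
    rw [← hp.sum_eq]; exact Equiv.sum_comp (Equiv.addLeft y) p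
  simp [this, hp.sum_eq]

theorem isProb_lazyDiff (hp : IsProb p) (h0 : 0 ≤ β) (h1 : β ≤ 1) : IsProb (lazyDiff β p) where
  nonneg z := by
    have : 0 ≤ ∑ y, p y * p (y + z) := sum_nonneg fun y _ => mul_nonneg (hp.nonneg _) (hp.nonneg _)
    unfold lazyDiff
    have : (0 : ℝ) ≤ if z = 0 then 1 else 0 := by split_ifs <;> norm_num
    nlinarith [mul_nonneg h0 ‹0 ≤ ∑ y, p y * p (y + z)›]
  sum_eq := by
    unfold lazyDiff
    rw [sum_add_distrib, ← mul_sum, ← mul_sum, sum_corr hp]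
    simp

/-- The reason for using this walk: its transform is real, nonnegative for `β ≤ 1`, and governed by
the same defect as `p`, but decays more slowly when `β` is small. -/
theorem ft_lazyDiff (t : F) :
    ft ψ (lazyDiff β p) t = ((1 - β * defect ψ p t : ℝ) : ℂ) := by
  have h := norm_sq_ft (ψ := ψ) (p := p) t
  have h2 : ∑ z, (((∑ y, p y * p (y + z) : ℝ)) : ℂ) * ψ (t * z) = ((‖ft ψ p t‖ ^ 2 : ℝ) : ℂ) := by
    rw [h, sum_comm]
    push_cast
    simp_rw [sum_mul]
    rw [sum_comm]
    refine sum_congr rfl fun y _ => ?_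
    rw [← Equiv.sum_comp (Equiv.addLeft y) fun x => (p x : ℂ) * p y * ψ (t * (x - y))]
    refine sum_congr rfl fun z _ => ?_
    simp only [Equiv.coe_addLeft, add_sub_cancel_left]
    ring
  have h3 : ft ψ (lazyDiff β p) t =
      (1 - β) + β * ∑ z, (((∑ y, p y * p (y + z) : ℝ)) : ℂ) * ψ (t * z) := by
    unfold ft lazyDiff
    rw [mul_sum]
    push_cast
    simp_rw [add_mul, sum_add_distrib]
    congr 1
    · simp [apply_ite]
    · exact sum_congr rfl fun _ _ => by ring
  rw [h3, h2, defect]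
  push_cast
  ring

theorem lazyDiff_le (hp : IsProb p) (hα : BalancedWeight α p) (h0 : 0 ≤ β) (h1 : β ≤ 1 / 2)
    (z : F) : lazyDiff β p z ≤ 1 - β * α := by
  have hc : ∑ y, p y * p (y + z) ≤ 1 - α := by
    refine (sum_le_sum fun y _ =>
      mul_le_mul_of_nonneg_left (hα.le_one_sub (y + z)) (hp.nonneg y)).trans_eq ?_
    rw [← sum_mul, hp.sum_eq, one_mul]
  have h2 := mul_le_mul_of_nonneg_left hc h0
  unfold lazyDiff
  split_ifs <;> linarith

end OneCoordinate

end

/-! ### Anticoncentration of `x ⬝ᵥ w` for one random row `x`. -/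

section

open scoped Classical
open Finset Matrix

variable {F : Type*} [Field F] [Fintype F] {J : Type*} [Fintype J]

/-- The size of the nontrivial part of the Fourier expansion of `P (X ⬝ᵥ w = 0)`. -/
noncomputable def rho (ψ : AddChar F ℂ) (p : J → F → ℝ) (w : J → F) : ℝ :=
  (Fintype.card F : ℝ)⁻¹ * ∑ t with t ≠ 0, ∏ j, ‖ft ψ (p j) (t * w j)‖

/-- The support of a vector. -/
noncomputable def supp (w : J → F) : Finset J := {j | w j ≠ 0}

section Rows

variable {ψ : AddChar F ℂ} {p : J → F → ℝ} {w : J → F} {α : ℝ}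

theorem rho_nonneg : 0 ≤ rho ψ p w :=
  mul_nonneg (by positivity) (sum_nonneg fun _ _ => prod_nonneg fun _ _ => norm_nonneg _)

theorem sum_eq_zero_add {R : Type*} [AddCommMonoid R] (f : F → R) :
    ∑ t, f t = f 0 + ∑ t with t ≠ 0, f t := by
  rw [← sum_erase_add univ f (mem_univ 0), add_comm]
  congr 2
  ext; simp

theorem card_ne_zero_le : (#{t : F | t ≠ 0} : ℝ) ≤ Fintype.card F :=
  mod_cast card_le_univ _

theorem card_field_pos : (0 : ℝ) < Fintype.card F := mod_cast Fintype.card_pos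

theorem prod_norm_ft_le_one (hp : ∀ j, IsProb (p j)) (u : J → F) :
    ∏ j, ‖ft ψ (p j) (u j)‖ ≤ 1 :=
  prod_le_one (fun _ _ => norm_nonneg _) fun j _ => norm_ft_le_one (hp j) _

theorem rho_le_one (hp : ∀ j, IsProb (p j)) : rho ψ p w ≤ 1 := by
  have hq := card_field_pos (F := F)
  rw [rho, inv_mul_le_one₀ hq]
  refine le_trans ?_ (card_ne_zero_le (F := F))
  refine (sum_le_sum fun t _ => prod_norm_ft_le_one hp _).trans_eq ?_
  simp

variable [DecidableEq J]

theorem _root_.AddChar.apply_sum {A R κ : Type*} [AddCommMonoid A] [CommMonoid R] (χ : AddChar A R)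
    (s : Finset κ) (f : κ → A) : χ (∑ k ∈ s, f k) = ∏ k ∈ s, χ (f k) := by
  induction s using Finset.cons_induction with
  | empty => simp
  | cons k s hk ih => rw [sum_cons, prod_cons, AddChar.map_add_eq_mul, ih]

theorem sum_prodWeight_char (u : J → F) :
    ∑ x : J → F, (prodWeight p x : ℂ) * ψ (u ⬝ᵥ x) = ∏ j, ft ψ (p j) (u j) := by
  unfold ft
  rw [← sum_prodWeight_mul (R := ℂ)]
  refine sum_congr rfl fun x _ => ?_
  rw [prod_mul_distrib, prodWeight, dotProduct, AddChar.apply_sum]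
  push_cast
  rfl

theorem pr_dotProduct_eq_zero (hψ : ψ.IsPrimitive) :
    (pr (prodWeight p) (fun x => x ⬝ᵥ w = 0) : ℂ) =
      (Fintype.card F : ℂ)⁻¹ * ∑ t, ∏ j, ft ψ (p j) (t * w j) := by
  have h1 : ∀ x : J → F, ((if x ⬝ᵥ w = 0 then (1 : ℝ) else 0 : ℝ) : ℂ) =
      (Fintype.card F : ℂ)⁻¹ * ∑ t, ψ ((fun j => t * w j) ⬝ᵥ x) := by
    intro x
    have h2 : ∀ t, (fun j => t * w j) ⬝ᵥ x = t * (x ⬝ᵥ w) := by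
      intro t
      simp only [dotProduct, mul_sum]
      exact sum_congr rfl fun j _ => by ring
    simp_rw [h2]
    rw [AddChar.sum_mulShift _ hψ]
    have : (Fintype.card F : ℂ) ≠ 0 := by simp
    split_ifs <;> simp
  unfold pr
  push_cast
  simp_rw [← sum_prodWeight_char]
  rw [sum_comm, mul_sum]
  refine sum_congr rfl fun x _ => ?_
  rw [← mul_sum, mul_left_comm, ← h1]

theorem abs_pr_dotProduct_sub_le (hψ : ψ.IsPrimitive) (hp : ∀ j, IsProb (p j)) :
    |pr (prodWeight p) (fun x => x ⬝ᵥ w = 0) - (Fintype.card F : ℝ)⁻¹| ≤ rho ψ p w := by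
  have h := pr_dotProduct_eq_zero (p := p) (w := w) hψ
  rw [sum_eq_zero_add, mul_add] at h
  simp only [zero_mul, ft_zero (hp _), prod_const_one, mul_one] at h
  have h2 : ((pr (prodWeight p) (fun x => x ⬝ᵥ w = 0) - (Fintype.card F : ℝ)⁻¹ : ℝ) : ℂ) =
      (Fintype.card F : ℂ)⁻¹ * ∑ t with t ≠ 0, ∏ j, ft ψ (p j) (t * w j) := by
    push_cast
    rw [h]
    ring
  rw [← Real.norm_eq_abs, ← Complex.norm_real, h2, norm_mul, norm_inv, Complex.norm_natCast, rho]
  refine mul_le_mul_of_nonneg_left ?_ (by positivity)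
  refine (norm_sum_le _ _).trans_eq ?_
  simp_rw [norm_prod]

theorem pr_dotProduct_le (hψ : ψ.IsPrimitive) (hp : ∀ j, IsProb (p j)) :
    pr (prodWeight p) (fun x => x ⬝ᵥ w = 0) ≤ (Fintype.card F : ℝ)⁻¹ + rho ψ p w := by
  linarith [le_abs_self (pr (prodWeight p) (fun x => x ⬝ᵥ w = 0) - (Fintype.card F : ℝ)⁻¹),
    abs_pr_dotProduct_sub_le (w := w) hψ hp]

theorem pr_lazyDiff_sub {β : ℝ} (hψ : ψ.IsPrimitive) (hp : ∀ j, IsProb (p j)) :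
    pr (prodWeight fun j => lazyDiff β (p j)) (fun x => x ⬝ᵥ w = 0) - (Fintype.card F : ℝ)⁻¹ =
      (Fintype.card F : ℝ)⁻¹ *
        ∑ t with t ≠ 0, ∏ j, (1 - β * defect ψ (p j) (t * w j)) := by
  have h := pr_dotProduct_eq_zero (p := fun j => lazyDiff β (p j)) (w := w) hψ
  simp_rw [ft_lazyDiff] at h
  rw [sum_eq_zero_add, mul_add] at h
  simp only [zero_mul, defect_zero (hp _), mul_zero, sub_zero, prod_const_one, mul_one,
    Complex.ofReal_one] at h
  apply Complex.ofReal_injective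
  push_cast at h ⊢
  rw [h]
  ring

/-- Anticoncentration by comparison with a lazy difference walk. -/
theorem two_pow_mul_rho_le (hψ : ψ.IsPrimitive) (hp : ∀ j, IsProb (p j))
    (hα : ∀ j, BalancedWeight α (p j)) (K : ℕ) :
    2 ^ K * rho ψ p w ≤
      pr (prodWeight fun j => lazyDiff ((16 : ℝ) ^ K * 4)⁻¹ (p j)) (fun x => x ⬝ᵥ w = 0) -
        (Fintype.card F : ℝ)⁻¹ + 2 ^ K * Real.exp (-(α * #(supp w) / (2 * 16 ^ K))) := by
  have hq := card_field_pos (F := F)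
  set β : ℝ := ((16 : ℝ) ^ K * 4)⁻¹ with hβ
  have h16 : (1 : ℝ) ≤ 16 ^ K := one_le_pow₀ (by norm_num)
  have hβ0 : 0 ≤ β := by positivity
  have hβ1 : β ≤ 1 / 2 := by
    rw [hβ, inv_le_comm₀ (by positivity) (by norm_num)]
    linarith
  set l := Real.exp (-(α * #(supp w) / (2 * 16 ^ K)))
  set D : F → ℝ := fun t => ∑ j, defect ψ (p j) (t * w j) with hD
  have hH : ∀ H : AddSubgroup F, H ≠ ⊥ → ∃ t ∈ H, α * #(supp w) ≤ D t := by
    intro H hH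
    have h1 : ∑ t : H, α * #(supp w) ≤ ∑ t : H, D t := by
      rw [hD, sum_comm, sum_const, card_univ, nsmul_eq_mul]
      have h2 : ∀ j, (if j ∈ supp w then Fintype.card H * α else 0) ≤
          ∑ t : H, defect ψ (p j) (t * w j) := by
        intro j
        split_ifs with hj
        · exact card_mul_le_sum_defect hψ (hp j) (hα j) (by simpa [supp] using hj) H hH
        · exact sum_nonneg fun _ _ => defect_nonneg (hp j) _
      refine le_trans (le_of_eq ?_) (sum_le_sum fun j _ => h2 j)
      rw [sum_ite_mem, univ_inter, sum_const, nsmul_eq_mul]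
      ring
    obtain ⟨t, -, ht⟩ := exists_le_of_sum_le (univ_nonempty (α := H)) h1
    exact ⟨t, t.2, ht⟩
  have hmain := mul_sum_le_of_card_superlevel_le (univ.filter fun t : F => t ≠ 0)
    (f := fun t => ∏ j, ‖ft ψ (p j) (t * w j)‖)
    (g := fun t => ∏ j, (1 - β * defect ψ (p j) (t * w j))) (m := 2 ^ K) (l := l)
    (by positivity) (Real.exp_nonneg _) (fun t _ => prod_norm_ft_le_one hp _)
    (fun t _ => prod_nonneg fun j _ => by
      nlinarith [defect_nonneg (ψ := ψ) (hp j) (t * w j),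
        defect_le_one (ψ := ψ) (p := p j) (t * w j)]) ?_
  · rw [pr_lazyDiff_sub hψ hp, rho, mul_left_comm]
    have h3 := mul_le_mul_of_nonneg_left hmain (inv_nonneg.2 hq.le)
    refine h3.trans ?_
    rw [mul_add]
    refine add_le_add_right ?_ _
    have h4 : (Fintype.card F : ℝ)⁻¹ * #{t : F | t ≠ 0} ≤ 1 := by
      rw [inv_mul_le_one₀ hq]; exact card_ne_zero_le
    calc (Fintype.card F : ℝ)⁻¹ * (2 ^ K * (#{t : F | t ≠ 0} * l))
        = ((Fintype.card F : ℝ)⁻¹ * #{t : F | t ≠ 0}) * (2 ^ K * l) := by ring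
      _ ≤ 1 * (2 ^ K * l) := mul_le_mul_of_nonneg_right h4 (by positivity)
      _ = _ := one_mul _
  · intro x hx0 hx1
    have hxpos : 0 < x := (Real.exp_pos _).trans hx0
    -- Write `f`, `g` for the two products. Since `f ≤ exp(-D/2)`, `x < f t` forces `D t ≤ u`. After
    -- `K` doublings the level is `16^K * u`, where `g ≥ exp(-2βD) ≥ exp(-u/2) = x`: this is what
    -- fixes `β = 1/(4 * 16^K)`. The cutoff `x > l` says exactly that `16^K * u` stays below `α *
    -- #(supp w)`, the height `D` reaches on every nontrivial subgroup.
    set u := -(2 * Real.log x)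
    have hu0 : 0 ≤ u := by
      have := Real.log_nonpos hxpos.le hx1.le
      linarith
    have hua : 16 ^ K * u < α * #(supp w) := by
      have := (Real.lt_log_iff_exp_lt hxpos).2 hx0
      have h5 : u < α * #(supp w) / 16 ^ K := by
        have : α * #(supp w) / 16 ^ K = 2 * (α * #(supp w) / (2 * 16 ^ K)) := by
          field_simp
        rw [this]
        linarith
      rwa [lt_div_iff₀' (by positivity)] at h5
    have h6 := two_pow_mul_card_sublevel_le (D := D)
      (by simp [hD, defect_zero (hp _)])
      (fun t => by simp [hD, neg_mul, defect_neg (hp _)])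
      (fun s t => by
        simp only [hD, mul_sum, ← sum_add_distrib, add_mul]
        exact sum_le_sum fun j _ => defect_add_le (hp j) _ _) hH hu0 K hua
    have h7 : #{t ∈ univ.filter fun t : F => t ≠ 0 | x < ∏ j, ‖ft ψ (p j) (t * w j)‖} ≤
        #{t | t ≠ 0 ∧ D t ≤ u} := by
      refine card_le_card fun t ht => ?_
      simp only [mem_filter, mem_univ, true_and] at ht ⊢
      refine ⟨ht.1, ?_⟩
      have h8 : x < Real.exp (-(D t) / 2) := by
        refine ht.2.trans_le ?_
        have : -(D t) / 2 = ∑ j, -(defect ψ (p j) (t * w j)) / 2 := by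
          rw [hD, ← sum_div, sum_neg_distrib]
        rw [this, Real.exp_sum]
        exact prod_le_prod (fun _ _ => norm_nonneg _) fun j _ => norm_ft_le_exp _
      have := (Real.log_lt_iff_lt_exp hxpos).2 h8
      linarith
    have h9 : #{t | t ≠ 0 ∧ D t ≤ 16 ^ K * u} ≤
        #{t ∈ univ.filter fun t : F => t ≠ 0 | x ≤ ∏ j, (1 - β * defect ψ (p j) (t * w j))} := by
      refine card_le_card fun t ht => ?_
      simp only [mem_filter, mem_univ, true_and] at ht ⊢
      refine ⟨ht.1, ?_⟩
      have h10 : Real.exp (-(2 * (β * D t))) ≤ ∏ j, (1 - β * defect ψ (p j) (t * w j)) := by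
        have : -(2 * (β * D t)) = ∑ j, -(2 * (β * defect ψ (p j) (t * w j))) := by
          rw [hD, sum_neg_distrib, ← mul_sum, ← mul_sum]
        rw [this, Real.exp_sum]
        refine prod_le_prod (fun _ _ => Real.exp_nonneg _) fun j _ => exp_neg_two_mul_le ?_ ?_
        · exact mul_nonneg hβ0 (defect_nonneg (hp j) _)
        · nlinarith [defect_nonneg (ψ := ψ) (hp j) (t * w j),
            defect_le_one (ψ := ψ) (p := p j) (t * w j)]
      refine le_trans ?_ h10
      rw [← Real.log_le_iff_le_exp hxpos]
      have h11 : β * D t ≤ u / 4 := by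
        have h12 := mul_le_mul_of_nonneg_left ht.2 hβ0
        refine h12.trans_eq ?_
        rw [hβ]
        field_simp
      linarith
    have h13 : 2 ^ K * #{t ∈ univ.filter fun t : F => t ≠ 0 | x < ∏ j, ‖ft ψ (p j) (t * w j)‖} ≤
        #{t ∈ univ.filter fun t : F => t ≠ 0 | x ≤ ∏ j, (1 - β * defect ψ (p j) (t * w j))} :=
      (Nat.mul_le_mul_left _ h7).trans (h6.trans h9)
    exact_mod_cast h13

theorem inv_card_le_half : (Fintype.card F : ℝ)⁻¹ ≤ 1 / 2 := by
  have : (2 : ℝ) ≤ Fintype.card F := mod_cast Fintype.one_lt_card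
  rw [inv_le_comm₀ (by linarith) (by norm_num)]
  linarith

/-- Three doublings suffice: `24576 = 3 * (2 * 16^3)` makes the exponential at most `e^{-3} ≤ 1/8`,
so `8 * rho ≤ 2 - 1/q`, and `1/q ≤ 1/2`. Only boundedness of the lazy probability by `1` is used. -/
theorem inv_card_add_rho_le (hψ : ψ.IsPrimitive) (hp : ∀ j, IsProb (p j))
    (hα : ∀ j, BalancedWeight α (p j)) (hs : 24576 ≤ α * #(supp w)) :
    (Fintype.card F : ℝ)⁻¹ + rho ψ p w ≤ 3 / 4 := by
  have h := two_pow_mul_rho_le (w := w) hψ hp hα 3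
  have h1 := pr_le_one (S := fun x => x ⬝ᵥ w = 0) (isProb_prodWeight fun j =>
    isProb_lazyDiff (hp j) (β := ((16 : ℝ) ^ 3 * 4)⁻¹) (by norm_num) (by norm_num))
  have h2 := inv_card_le_half (F := F)
  have h3 : Real.exp (-(α * #(supp w) / (2 * 16 ^ 3))) ≤ 1 / 8 := by
    have : Real.exp (-(α * #(supp w) / (2 * 16 ^ 3))) ≤ Real.exp (-3) := by
      rw [Real.exp_le_exp]
      norm_num
      rw [le_div_iff₀ (by norm_num)]
      linarith
    refine this.trans ?_
    have h4 := Real.exp_one_gt_d9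
    have h5 : Real.exp 3 = Real.exp 1 ^ 3 := by rw [← Real.exp_nat_mul]; norm_num
    have h6 : (8 : ℝ) ≤ Real.exp 1 ^ 3 := by
      have : (2 : ℝ) ^ 3 ≤ Real.exp 1 ^ 3 := pow_le_pow_left₀ (by norm_num) (by linarith) 3
      linarith
    rw [Real.exp_neg, h5, inv_le_comm₀ (by positivity) (by norm_num)]
    linarith
  have h4 : 0 ≤ (Fintype.card F : ℝ)⁻¹ := by positivity
  norm_num at h
  norm_num at h1 h3
  linarith

end Rows

end

/-! ### Mass of a subspace, and Fourier inversion over the kernel of a family of rows. -/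

section

open scoped Classical
open Finset Matrix

variable {F : Type*} [Field F] [Fintype F]

theorem pr_prodWeight_succ {n : ℕ} {E : Type*} [Fintype E] (p : Fin (n + 1) → E → ℝ)
    (S : (Fin (n + 1) → E) → Prop) :
    pr (prodWeight p) S =
      ∑ y, prodWeight (fun j => p j.succ) y * pr (p 0) (fun a => S (Fin.cons a y)) := by
  simp only [pr, mul_sum]
  rw [sum_comm, ← Fintype.sum_prod_type']
  refine (Fintype.sum_equiv (Fin.consEquiv fun _ => E) _ _ fun x => ?_).symm
  have h : Fin.consEquiv (fun _ => E) x = Fin.cons x.1 x.2 := rfl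
  simp only [h, prodWeight, Fin.prod_univ_succ, Fin.cons_zero, Fin.cons_succ]
  ring

/-- A subspace of codimension `d` has mass at most `c ^ d` when all atoms of the coordinates have
mass at most `c`. -/
theorem pr_mem_submodule_le {n : ℕ} {p : Fin n → F → ℝ} (hp : ∀ j, IsProb (p j)) {c : ℝ}
    (hc0 : 0 ≤ c) (hc1 : c ≤ 1) (hc : ∀ j x, p j x ≤ c) (V : Submodule F (Fin n → F)) :
    pr (prodWeight p) (fun x => x ∈ V) ≤ c ^ (n - Module.finrank F V) := by
  induction n with
  | zero => simpa using pr_le_one (isProb_prodWeight hp)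
  | succ n ih =>
    let T : (Fin (n + 1) → F) →ₗ[F] (Fin n → F) := LinearMap.funLeft F F Fin.succ
    have hT : ∀ a (y : Fin n → F), T (Fin.cons a y) = y := fun a y => by
      ext j; simp [T, LinearMap.funLeft_apply]
    have hrank := LinearMap.finrank_range_add_finrank_ker (T.domRestrict V)
    rw [LinearMap.range_domRestrict] at hrank
    have hV : Module.finrank F V ≤ n + 1 := by simpa using Submodule.finrank_le V
    have hV' : Module.finrank F (V.map T) ≤ n := by simpa using Submodule.finrank_le (V.map T)
    have hIH := ih (fun j => hp j.succ) (fun j => hc j.succ) (V.map T)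
    rw [pr_prodWeight_succ]
    have hmem : ∀ a (y : Fin n → F), (Fin.cons a y : Fin (n + 1) → F) ∈ V → y ∈ V.map T :=
      fun a y h => ⟨_, h, hT a y⟩
    have hbound : ∀ e : ℝ, (∀ y, pr (p 0) (fun a => (Fin.cons a y : Fin (n + 1) → F) ∈ V) ≤ e) →
        ∑ y, prodWeight (fun j => p j.succ) y *
          pr (p 0) (fun a => (Fin.cons a y : Fin (n + 1) → F) ∈ V) ≤
            e * pr (prodWeight fun j => p j.succ) (fun y => y ∈ V.map T) := by
      intro e he
      unfold pr
      rw [mul_sum]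
      refine sum_le_sum fun y _ => ?_
      rw [mul_left_comm]
      refine mul_le_mul_of_nonneg_left ?_ (prod_nonneg fun j _ => (hp _).nonneg _)
      split_ifs with hy
      · simpa [pr] using he y
      · rw [mul_zero]
        refine (sum_eq_zero fun a _ => ?_).le
        rw [if_neg fun h => hy (hmem a y h), mul_zero]
    -- Drop the first coordinate. If `V` contains a nonzero multiple of the first basis vector, the
    -- projection loses dimension and the codimension does not grow. Otherwise the first coordinate
    -- is determined by the others and costs a factor `c`.
    by_cases hk : ∃ a : F, a ≠ 0 ∧ (Fin.cons a 0 : Fin (n + 1) → F) ∈ V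
    · obtain ⟨a, ha, haV⟩ := hk
      have h1 := hbound 1 fun y => pr_le_one (hp 0)
      refine h1.trans ?_
      rw [one_mul]
      refine hIH.trans (pow_le_pow_of_le_one hc0 hc1 ?_)
      have hker : 0 < Module.finrank F (LinearMap.ker (T.domRestrict V)) := by
        refine Nat.pos_of_ne_zero fun h => ?_
        replace h := Submodule.finrank_eq_zero.1 h
        have h2 : (⟨Fin.cons a 0, haV⟩ : V) ∈ LinearMap.ker (T.domRestrict V) := by
          rw [LinearMap.mem_ker, LinearMap.domRestrict_apply, hT]
        rw [h, Submodule.mem_bot] at h2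
        have := congrFun (congrArg Subtype.val h2) 0
        exact ha (by simpa using this)
      omega
    · push Not at hk
      have h1 := hbound c fun y => by
        by_cases hy : ∃ a : F, (Fin.cons a y : Fin (n + 1) → F) ∈ V
        · obtain ⟨a, ha⟩ := hy
          refine le_trans ?_ (hc 0 a)
          have : pr (p 0) (fun b => (Fin.cons b y : Fin (n + 1) → F) ∈ V) ≤
              pr (p 0) (fun b => b = a) := by
            refine pr_mono (hp 0).nonneg fun b hb => ?_
            by_contra hne
            refine hk (b - a) (sub_ne_zero.2 hne) ?_
            have h3 := V.sub_mem hb ha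
            convert h3 using 1
            ext j
            refine Fin.cases ?_ (fun j => ?_) j <;> simp
          refine this.trans_eq ?_
          simp [pr]
        · push Not at hy
          simp [pr, hy, hc0]
      refine h1.trans ?_
      refine (mul_le_mul_of_nonneg_left hIH hc0).trans ?_
      rw [← pow_succ']
      exact pow_le_pow_of_le_one hc0 hc1 (by omega)

section Kernel

variable {J ι : Type*} [Fintype J] [Fintype ι] [DecidableEq J]

/-- The vectors orthogonal to all members of a family. -/
noncomputable def kerRows (A : ι → J → F) : Finset (J → F) := {w | ∀ i, A i ⬝ᵥ w = 0}

theorem mem_kerRows {A : ι → J → F} {w : J → F} : w ∈ kerRows A ↔ ∀ i, A i ⬝ᵥ w = 0 := by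
  simp [kerRows]

omit [Fintype F] [DecidableEq J] in
theorem dotProductBilin_nondegenerate :
    LinearMap.BilinForm.Nondegenerate (dotProductBilin F F : LinearMap.BilinForm F (J → F)) := by
  constructor
  · intro x hx
    exact dotProduct_eq_zero x fun y => hx y
  · intro x hx
    exact dotProduct_eq_zero x fun y => by rw [dotProduct_comm]; exact hx y

theorem mem_orthogonal_span_iff {A : ι → J → F} {w : J → F} :
    w ∈ LinearMap.BilinForm.orthogonal (dotProductBilin F F : LinearMap.BilinForm F (J → F))
      (Submodule.span F (Set.range A)) ↔ w ∈ kerRows A := by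
  rw [LinearMap.BilinForm.mem_orthogonal_iff, mem_kerRows]
  constructor
  · exact fun h i => h _ (Submodule.subset_span ⟨i, rfl⟩)
  · intro h x hx
    induction hx using Submodule.span_induction with
    | mem x hx => obtain ⟨i, rfl⟩ := hx; exact h i
    | zero => exact zero_dotProduct w
    | add x y _ _ hx hy => exact (add_dotProduct x y w).trans (by rw [show x ⬝ᵥ w = 0 from hx,
        show y ⬝ᵥ w = 0 from hy, add_zero])
    | smul a x _ hx => exact (smul_dotProduct a x w).trans (by rw [show x ⬝ᵥ w = 0 from hx, smul_zero])

theorem mem_span_iff_forall_kerRows {A : ι → J → F} {x : J → F} :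
    x ∈ Submodule.span F (Set.range A) ↔ ∀ w ∈ kerRows A, w ⬝ᵥ x = 0 := by
  have hrefl : (dotProductBilin F F : LinearMap.BilinForm F (J → F)).IsRefl := fun x y h => by
    have h' : x ⬝ᵥ y = 0 := h
    rw [dotProduct_comm] at h'
    exact h'
  have h := LinearMap.BilinForm.orthogonal_orthogonal dotProductBilin_nondegenerate hrefl
    (Submodule.span F (Set.range A))
  rw [← h, LinearMap.BilinForm.mem_orthogonal_iff]
  refine forall_congr' fun w => ?_
  rw [mem_orthogonal_span_iff]
  rfl

theorem card_kerRows {A : ι → J → F} (hA : LinearIndependent F A) :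
    #(kerRows A) = Fintype.card F ^ (Fintype.card J - Fintype.card ι) := by
  have h := LinearMap.BilinForm.finrank_orthogonal
    (dotProductBilin_nondegenerate (F := F) (J := J)) (Submodule.span F (Set.range A))
  rw [finrank_span_eq_card hA, Module.finrank_fintype_fun_eq_card] at h
  rw [← h, ← Module.card_eq_pow_finrank, ← Fintype.card_coe]
  exact Fintype.card_congr (Equiv.subtypeEquivRight fun w => mem_orthogonal_span_iff.symm)

variable {ψ : AddChar F ℂ} {p : J → F → ℝ} {A : ι → J → F}

theorem sum_kerRows_char (hψ : ψ.IsPrimitive) (x : J → F) :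
    ∑ w ∈ kerRows A, ψ (w ⬝ᵥ x) =
      #(kerRows A) * if x ∈ Submodule.span F (Set.range A) then 1 else 0 := by
  split_ifs with hx
  · rw [mem_span_iff_forall_kerRows] at hx
    rw [sum_congr rfl fun w hw => by rw [hx w hw, AddChar.map_zero_eq_one]]
    simp
  · rw [mul_zero]
    rw [mem_span_iff_forall_kerRows] at hx
    push Not at hx
    obtain ⟨w₀, hw₀, hne⟩ := hx
    obtain ⟨t, ht⟩ : ∃ t, ψ (t * (w₀ ⬝ᵥ x)) ≠ 1 := by
      by_contra! hcon
      refine hψ hne ?_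
      ext t
      rw [AddChar.mulShift_apply, mul_comm, hcon, AddChar.one_apply]
    have hu : t • w₀ ∈ kerRows A := mem_kerRows.2 fun i => by
      rw [dotProduct_smul, mem_kerRows.1 hw₀ i, smul_zero]
    have hshift : ∑ w ∈ kerRows A, ψ (w ⬝ᵥ x) = ∑ w ∈ kerRows A, ψ ((w + t • w₀) ⬝ᵥ x) := by
      symm
      refine sum_equiv (Equiv.addRight (t • w₀)) (fun w => ?_) fun w _ => rfl
      simp only [Equiv.coe_addRight, mem_kerRows, dotProduct_add]
      exact forall_congr' fun i => by rw [mem_kerRows.1 hu i, add_zero]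
    simp_rw [add_dotProduct, AddChar.map_add_eq_mul, ← sum_mul, smul_dotProduct, smul_eq_mul]
      at hshift
    have h0 : (∑ w ∈ kerRows A, ψ (w ⬝ᵥ x)) * (1 - ψ (t * (w₀ ⬝ᵥ x))) = 0 := by
      rw [mul_sub, mul_one, ← hshift, sub_self]
    exact (mul_eq_zero.1 h0).resolve_right (sub_ne_zero.2 (Ne.symm ht))

/-- The indicator of the span is the average of the characters `ψ (w ⬝ᵥ ·)` over the kernel; `w = 0`
gives the main term. -/
theorem abs_pr_mem_span_sub_le (hψ : ψ.IsPrimitive) (hp : ∀ j, IsProb (p j))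
    (hA : LinearIndependent F A) :
    |pr (prodWeight p) (fun x => x ∈ Submodule.span F (Set.range A)) -
        ((Fintype.card F : ℝ) ^ (Fintype.card J - Fintype.card ι))⁻¹| ≤
      ((Fintype.card F : ℝ) ^ (Fintype.card J - Fintype.card ι))⁻¹ *
        ∑ w ∈ kerRows A with w ≠ 0, ∏ j, ‖ft ψ (p j) (w j)‖ := by
  have hN : ((#(kerRows A) : ℕ) : ℝ) =
      (Fintype.card F : ℝ) ^ (Fintype.card J - Fintype.card ι) := mod_cast card_kerRows hA
  rw [← hN]
  have h0 : (0 : J → F) ∈ kerRows A := mem_kerRows.2 fun i => dotProduct_zero _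
  have hNpos : (#(kerRows A) : ℂ) ≠ 0 := mod_cast (card_pos.2 ⟨_, h0⟩).ne'
  have h1 : (pr (prodWeight p) (fun x => x ∈ Submodule.span F (Set.range A)) : ℂ) =
      (#(kerRows A) : ℂ)⁻¹ * ∑ w ∈ kerRows A, ∏ j, ft ψ (p j) (w j) := by
    simp_rw [← sum_prodWeight_char]
    rw [sum_comm]
    simp_rw [← mul_sum, sum_kerRows_char hψ]
    unfold pr
    push_cast
    rw [mul_sum]
    refine sum_congr rfl fun x _ => ?_
    rw [mul_left_comm (prodWeight p x : ℂ), inv_mul_cancel_left₀ hNpos]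
    split_ifs <;> simp
  have h2 : ∑ w ∈ kerRows A, ∏ j, ft ψ (p j) (w j) =
      1 + ∑ w ∈ kerRows A with w ≠ 0, ∏ j, ft ψ (p j) (w j) := by
    rw [← add_sum_erase _ _ h0]
    congr 1
    · simp [ft_zero (hp _)]
    · refine sum_congr ?_ fun _ _ => rfl
      ext w; simp [and_comm]
  have h3 : ((pr (prodWeight p) (fun x => x ∈ Submodule.span F (Set.range A)) -
      (#(kerRows A) : ℝ)⁻¹ : ℝ) : ℂ) =
        (#(kerRows A) : ℂ)⁻¹ * ∑ w ∈ kerRows A with w ≠ 0, ∏ j, ft ψ (p j) (w j) := by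
    push_cast
    rw [h1, h2]
    ring
  rw [← Real.norm_eq_abs, ← Complex.norm_real, h3, norm_mul, norm_inv, Complex.norm_natCast]
  refine mul_le_mul_of_nonneg_left ?_ (by positivity)
  refine (norm_sum_le _ _).trans_eq ?_
  simp_rw [norm_prod]

/-- The kernel is stable under nonzero scalars, so summing `rho` over it gives `(1 - 1/q)` times the
sum of products, and `1 - 1/q ≥ 1/2`. -/
theorem sum_kerRows_le_two_mul_rho :
    ∑ w ∈ kerRows A with w ≠ 0, ∏ j, ‖ft ψ (p j) (w j)‖ ≤
      2 * ∑ w ∈ kerRows A with w ≠ 0, rho ψ p w := by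
  set f : (J → F) → ℝ := fun w => ∏ j, ‖ft ψ (p j) (w j)‖ with hf
  set S := ∑ w ∈ kerRows A with w ≠ 0, f w
  have hS0 : 0 ≤ S := sum_nonneg fun _ _ => prod_nonneg fun _ _ => norm_nonneg _
  have hq := card_field_pos (F := F)
  have hscale : ∀ t : F, t ≠ 0 →
      ∑ w ∈ kerRows A with w ≠ 0, ∏ j, ‖ft ψ (p j) (t * w j)‖ = S := by
    intro t ht
    refine sum_equiv (MulAction.toPerm (Units.mk0 t ht)) (fun w => ?_) fun w _ => ?_
    · simp only [mem_filter, mem_kerRows, MulAction.toPerm_apply, Units.smul_mk0, dotProduct_smul,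
        smul_eq_mul, mul_eq_zero, ht, false_or, ne_eq, smul_eq_zero]
    · simp [hf, Units.smul_mk0]
  have h1 : ∑ w ∈ kerRows A with w ≠ 0, rho ψ p w =
      (Fintype.card F : ℝ)⁻¹ * (#{t : F | t ≠ 0} * S) := by
    unfold rho
    rw [← mul_sum, sum_comm, sum_congr rfl fun t ht => hscale t (by simpa using ht)]
    simp
  have h2 : (#{t : F | t ≠ 0} : ℝ) = Fintype.card F - 1 := by
    have := filter_ne' (univ : Finset F) 0
    rw [this, card_erase_of_mem (mem_univ _), card_univ, Nat.cast_sub Fintype.card_pos]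
    simp
  rw [h1, h2]
  have h3 := inv_card_le_half (F := F)
  have h4 : (Fintype.card F : ℝ)⁻¹ * ((Fintype.card F - 1) * S) =
      (1 - (Fintype.card F : ℝ)⁻¹) * S := by field_simp
  rw [h4]
  nlinarith

end Kernel

end

/-! ### Sparse kernel vectors by a union bound; unstructured ones by a moment count. -/

section

open scoped Classical
open Finset Matrix

variable {F : Type*} [Field F] [Fintype F] {J ι : Type*} [Fintype J] [Fintype ι] [DecidableEq J]
  [DecidableEq ι]

section Sparse

omit [Fintype F] [Fintype ι] [DecidableEq J] [DecidableEq ι] in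
theorem dotProduct_eq_sum_of_supp {w : J → F} {S : Finset J} (hw : supp w = S) (x : J → F) :
    x ⬝ᵥ w = (fun j : S => x j) ⬝ᵥ fun j : S => w j := by
  unfold dotProduct
  rw [sum_coe_sort S fun j => x j * w j]
  refine (sum_subset (subset_univ S) fun j _ hj => ?_).symm
  have : w j = 0 := by
    by_contra h
    exact hj (hw ▸ by simpa [supp] using h)
  rw [this, mul_zero]

omit [Fintype F] [DecidableEq J] [DecidableEq ι] in
/-- The rows of a matrix, restricted to a set `S` of columns, are controlled by `#S` of them. -/
theorem exists_controlling_rows (A : ι → J → F) (S : Finset J) (hS : #S ≤ Fintype.card ι) :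
    ∃ B : Finset ι, #B = #S ∧ ∀ w : J → F, supp w = S → (∀ i ∈ B, A i ⬝ᵥ w = 0) →
      ∀ i, A i ⬝ᵥ w = 0 := by
  let r : ι → S → F := fun i j => A i j
  -- A maximal independent set of restricted rows has at most `#S` members; it is padded to exactly
  -- `#S` so that the number of remaining rows is fixed.
  obtain ⟨b, -, -, hspan, hb⟩ := exists_linearIndepOn_extension
    (linearIndepOn_empty F r) (Set.empty_subset Set.univ)
  have hcard : #b.toFinset ≤ #S := by
    have := LinearIndependent.fintype_card_le_finrank hb
    rwa [Module.finrank_fintype_fun_eq_card, Fintype.card_coe, ← Set.toFinset_card] at this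
  obtain ⟨B, hbB, hB⟩ := exists_superset_card_eq hcard hS
  refine ⟨B, hB, fun w hw hw0 i => ?_⟩
  rw [dotProduct_eq_sum_of_supp hw]
  have hi : r i ∈ Submodule.span F (r '' b) := hspan ⟨i, trivial, rfl⟩
  change r i ⬝ᵥ _ = 0
  generalize r i = y at hi ⊢
  induction hi using Submodule.span_induction with
  | mem x hx =>
    obtain ⟨i, hi, rfl⟩ := hx
    rw [← dotProduct_eq_sum_of_supp hw]
    exact hw0 i (hbB (by simpa using hi))
  | zero => exact zero_dotProduct _
  | add x y _ _ hx hy => rw [add_dotProduct, hx, hy, add_zero]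
  | smul a x _ hx => rw [smul_dotProduct, hx, smul_zero]

variable {p : ι → J → F → ℝ}

theorem pr_exists_supp_eq_le (hp : ∀ i j, IsProb (p i j)) (S : Finset J)
    (hS : #S ≤ Fintype.card ι) {c : ℝ}
    (hc : ∀ i (w : J → F), supp w = S → pr (prodWeight (p i)) (fun x => x ⬝ᵥ w = 0) ≤ c) :
    pr (prodWeight fun i => prodWeight (p i))
        (fun A : ι → J → F => ∃ w, supp w = S ∧ ∀ i, A i ⬝ᵥ w = 0) ≤
      (Fintype.card ι).choose #S * c ^ (Fintype.card ι - #S) := by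
  have hR : ∀ i, IsProb (prodWeight (p i)) := fun i => isProb_prodWeight (hp i)
  -- The test vector must depend on the rows in `B` alone, so that the other rows are independent of
  -- it. When no kernel vector with support `S` exists, the indicator of `S` serves, keeping `supp
  -- w₀ = S` so that `hc` still applies.
  have hex : ∀ (B : Finset ι) (a : {i // i ∈ B} → J → F), ∃ w₀ : J → F, supp w₀ = S ∧
      ∀ w, supp w = S → (∀ i, a i ⬝ᵥ w = 0) → ∀ i, a i ⬝ᵥ w₀ = 0 := by
    intro B a
    by_cases h : ∃ w, supp w = S ∧ ∀ i, a i ⬝ᵥ w = 0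
    · obtain ⟨w, hw, hw0⟩ := h
      exact ⟨w, hw, fun _ _ _ => hw0⟩
    · push Not at h
      refine ⟨fun j => if j ∈ S then 1 else 0, by ext j; simp [supp], fun w hw hw0 => ?_⟩
      obtain ⟨i, hi⟩ := h w hw
      exact absurd (hw0 i) hi
  choose w₀ hw₀ hw₀' using hex
  have h1 : pr (prodWeight fun i => prodWeight (p i))
        (fun A : ι → J → F => ∃ w, supp w = S ∧ ∀ i, A i ⬝ᵥ w = 0) ≤
      pr (prodWeight fun i => prodWeight (p i))
        (fun A : ι → J → F => ∃ B ∈ powersetCard #S univ,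
          ∀ i, i ∉ B → A i ⬝ᵥ w₀ B (fun j => A j) = 0) := by
    refine pr_mono (isProb_prodWeight hR).nonneg fun A ⟨w, hw, hw0⟩ => ?_
    obtain ⟨B, hB, hctrl⟩ := exists_controlling_rows A S hS
    refine ⟨B, mem_powersetCard.2 ⟨subset_univ _, hB⟩, fun i _ => ?_⟩
    refine hctrl _ (hw₀ B _) (fun i hi => ?_) i
    exact hw₀' B (fun j => A j) w hw (fun i => hw0 i) ⟨i, hi⟩
  refine h1.trans ((pr_exists_le (isProb_prodWeight hR).nonneg _ _).trans ?_)
  have h2 : ∀ B ∈ powersetCard #S (univ : Finset ι),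
      pr (prodWeight fun i => prodWeight (p i))
        (fun A : ι → J → F => ∀ i, i ∉ B → A i ⬝ᵥ w₀ B (fun j => A j) = 0) ≤
      c ^ (Fintype.card ι - #S) := by
    intro B hB
    rw [← (mem_powersetCard.1 hB).2]
    exact pr_forall_notMem_le hR B (fun a x => x ⬝ᵥ w₀ B a = 0) fun a i => hc i _ (hw₀ B a)
  refine (sum_le_sum h2).trans_eq ?_
  rw [sum_const, card_powersetCard, card_univ, nsmul_eq_mul]

/-- Sparse vectors are unlikely to be in the kernel. -/
theorem pr_exists_sparse_le (hp : ∀ i j, IsProb (p i j)) {m : ℕ} (hm : m ≤ Fintype.card ι)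
    {c : ℕ → ℝ}
    (hc : ∀ i (w : J → F), 1 ≤ #(supp w) → #(supp w) ≤ m →
      pr (prodWeight (p i)) (fun x => x ⬝ᵥ w = 0) ≤ c #(supp w)) :
    pr (prodWeight fun i => prodWeight (p i))
        (fun A : ι → J → F => ∃ w, w ≠ 0 ∧ #(supp w) ≤ m ∧ ∀ i, A i ⬝ᵥ w = 0) ≤
      ∑ s ∈ Icc 1 m, (Fintype.card J).choose s *
        ((Fintype.card ι).choose s * c s ^ (Fintype.card ι - s)) := by
  have hR : IsProb (prodWeight fun i => prodWeight (p i)) :=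
    isProb_prodWeight fun i => isProb_prodWeight (hp i)
  have h1 : pr (prodWeight fun i => prodWeight (p i))
        (fun A : ι → J → F => ∃ w, w ≠ 0 ∧ #(supp w) ≤ m ∧ ∀ i, A i ⬝ᵥ w = 0) ≤
      pr (prodWeight fun i => prodWeight (p i))
        (fun A : ι → J → F => ∃ s ∈ Icc 1 m, ∃ S ∈ powersetCard s univ,
          ∃ w, supp w = S ∧ ∀ i, A i ⬝ᵥ w = 0) := by
    refine pr_mono hR.nonneg fun A ⟨w, hw, hm, hw0⟩ => ?_
    refine ⟨#(supp w), mem_Icc.2 ⟨card_pos.2 ?_, hm⟩, supp w,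
      mem_powersetCard.2 ⟨subset_univ _, rfl⟩, w, rfl, hw0⟩
    obtain ⟨j, hj⟩ := Function.ne_iff.1 hw
    exact ⟨j, by simpa [supp] using hj⟩
  refine h1.trans ((pr_exists_le hR.nonneg _ _).trans (sum_le_sum fun s hs => ?_))
  refine (pr_exists_le hR.nonneg _ _).trans ?_
  have h2 : ∀ S ∈ powersetCard s (univ : Finset J), pr (prodWeight fun i => prodWeight (p i))
      (fun A : ι → J → F => ∃ w, supp w = S ∧ ∀ i, A i ⬝ᵥ w = 0) ≤
        (Fintype.card ι).choose s * c s ^ (Fintype.card ι - s) := by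
    intro S hS
    obtain rfl := (mem_powersetCard.1 hS).2
    obtain ⟨hs1, hs2⟩ := mem_Icc.1 hs
    refine pr_exists_supp_eq_le hp S (hs2.trans hm) fun i w hw => ?_
    rw [← hw] at hs1 hs2 ⊢
    exact hc i w hs1 hs2
  refine (sum_le_sum h2).trans_eq ?_
  rw [sum_const, card_powersetCard, card_univ, nsmul_eq_mul]

end Sparse

section Count

variable {ψ : AddChar F ℂ} {α : ℝ}

omit [DecidableEq J] in
theorem rho_pow_le {p : J → F → ℝ} {w : J → F} {L : ℕ} (hL : L ≠ 0) :
    rho ψ p w ^ L ≤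
      (Fintype.card F : ℝ)⁻¹ * ∑ t with t ≠ 0, ∏ j, ‖ft ψ (p j) (t * w j)‖ ^ L := by
  have hq := card_field_pos (F := F)
  have h := Real.pow_arith_mean_le_arith_mean_pow (univ : Finset F)
    (fun _ => (Fintype.card F : ℝ)⁻¹)
    (fun t => if t ≠ 0 then ∏ j, ‖ft ψ (p j) (t * w j)‖ else 0) (fun _ _ => by positivity)
    (by rw [sum_const, card_univ, nsmul_eq_mul, mul_inv_cancel₀ hq.ne'])
    (fun t _ => by split_ifs <;> positivity) L
  rw [← mul_sum, ← mul_sum] at h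
  unfold rho
  rw [sum_filter, sum_filter]
  refine h.trans_eq ?_
  congr 1
  refine sum_congr rfl fun t _ => ?_
  split_ifs with ht
  · rw [prod_pow]
  · exact zero_pow hL

/-- Up to normalisation and the term at `0`, the `L`-th moment is `rho` of the all-ones vector for
`L` identical coordinates, so `inv_card_add_rho_le` applies. -/
theorem sum_norm_ft_pow_le {p : F → ℝ} (hψ : ψ.IsPrimitive) (hp : IsProb p)
    (hα : BalancedWeight α p) {L : ℕ} (hL : 24576 ≤ α * L) :
    ∑ x, ‖ft ψ p x‖ ^ L ≤ 3 / 4 * Fintype.card F := by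
  have hq := card_field_pos (F := F)
  have h := inv_card_add_rho_le (J := Fin L) (p := fun _ => p) (w := fun _ => (1 : F)) hψ
    (fun _ => hp) (fun _ => hα) (by simpa [supp] using hL)
  simp only [rho, mul_one, prod_const, card_univ, Fintype.card_fin] at h
  rw [sum_eq_zero_add, ft_zero hp, norm_one, one_pow]
  have h2 := mul_le_mul_of_nonneg_left h hq.le
  rw [mul_add, mul_inv_cancel₀ hq.ne', mul_inv_cancel_left₀ hq.ne'] at h2
  linarith

/-- `rho_pow_le` (Jensen) moves the power inside the average over `t`; the sum over all `w` then
factors over coordinates. With Markov's inequality this counts the vectors that are not negligible.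
-/
theorem sum_rho_pow_le {p : J → F → ℝ} (hψ : ψ.IsPrimitive) (hp : ∀ j, IsProb (p j))
    (hα : ∀ j, BalancedWeight α (p j)) {L : ℕ} (hL0 : L ≠ 0) (hL : 24576 ≤ α * L) :
    ∑ w : J → F, rho ψ p w ^ L ≤ (3 / 4 * Fintype.card F) ^ Fintype.card J := by
  have hq := card_field_pos (F := F)
  refine (sum_le_sum fun w _ => rho_pow_le hL0).trans ?_
  rw [← mul_sum, sum_comm]
  have h1 : ∀ t ∈ univ.filter fun t : F => t ≠ 0,
      ∑ w : J → F, ∏ j, ‖ft ψ (p j) (t * w j)‖ ^ L ≤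
        (3 / 4 * Fintype.card F) ^ Fintype.card J := by
    intro t ht
    have ht0 : t ≠ 0 := by simpa using ht
    rw [sum_prodWeight_mul (fun j x => ‖ft ψ (p j) (t * x)‖ ^ L)]
    have h2 : ∀ j, ∑ x, ‖ft ψ (p j) (t * x)‖ ^ L ≤ 3 / 4 * Fintype.card F := by
      intro j
      refine (Equiv.sum_comp (Equiv.mulLeft₀ t ht0) fun x => ‖ft ψ (p j) x‖ ^ L).trans_le ?_
      exact sum_norm_ft_pow_le hψ (hp j) (hα j) hL
    refine (prod_le_prod (fun j _ => by positivity) fun j _ => h2 j).trans_eq ?_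
    rw [prod_const, card_univ]
  refine (mul_le_mul_of_nonneg_left (sum_le_sum h1) (by positivity)).trans ?_
  rw [sum_const, nsmul_eq_mul, ← mul_assoc]
  refine mul_le_of_le_one_left (by positivity) ?_
  rw [inv_mul_le_one₀ hq]
  exact card_ne_zero_le

/-- The expected number of kernel vectors which are unstructured for all rows but not negligible
for the row with entries `p'`. -/
theorem sum_pr_unstructured_le {p : ι → J → F → ℝ} {p' : J → F → ℝ} (hψ : ψ.IsPrimitive)
    (hp : ∀ i j, IsProb (p i j)) (hp' : ∀ j, IsProb (p' j))
    (hα : ∀ j, BalancedWeight α (p' j)) {L : ℕ} (hL0 : L ≠ 0) (hL : 24576 ≤ α * L) {ε : ℝ}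
    (hε : 0 < ε) {C : Finset (J → F)}
    (hC : ∀ w ∈ C, ε ≤ rho ψ p' w ∧ ∀ i, rho ψ (p i) w ≤ 1 / 10 * (Fintype.card F : ℝ)⁻¹) :
    ∑ w ∈ C, pr (prodWeight fun i => prodWeight (p i)) (fun A => ∀ i, A i ⬝ᵥ w = 0) ≤
      (ε ^ L)⁻¹ * (3 / 4 * Fintype.card F) ^ Fintype.card J *
        (11 / 10 * (Fintype.card F : ℝ)⁻¹) ^ Fintype.card ι := by
  have hq := card_field_pos (F := F)
  have h1 : ∀ w ∈ C, pr (prodWeight fun i => prodWeight (p i)) (fun A => ∀ i, A i ⬝ᵥ w = 0) ≤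
      (11 / 10 * (Fintype.card F : ℝ)⁻¹) ^ Fintype.card ι := by
    intro w hw
    rw [pr_forall (fun i => prodWeight (p i)) fun _ x => x ⬝ᵥ w = 0]
    refine (prod_le_prod (g := fun _ => 11 / 10 * (Fintype.card F : ℝ)⁻¹)
      (fun i _ => pr_nonneg (isProb_prodWeight (hp i)).nonneg) fun i _ => ?_).trans_eq ?_
    · have := pr_dotProduct_le (w := w) hψ (hp i)
      have := (hC w hw).2 i
      linarith
    · rw [prod_const, card_univ]
  -- Markov's inequality for the `L`-th power of `rho`.
  have h2 : (#C : ℝ) ≤ (ε ^ L)⁻¹ * (3 / 4 * Fintype.card F) ^ Fintype.card J := by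
    rw [← div_eq_inv_mul, le_div_iff₀ (by positivity)]
    refine le_trans ?_ (sum_rho_pow_le hψ hp' hα hL0 hL)
    rw [← nsmul_eq_mul, ← sum_const]
    refine (sum_le_sum fun w hw => pow_le_pow_left₀ hε.le (hC w hw).1 L).trans ?_
    exact sum_le_sum_of_subset_of_nonneg (subset_univ _) fun _ _ _ => pow_nonneg rho_nonneg L
  refine (sum_le_sum h1).trans ?_
  rw [sum_const, nsmul_eq_mul]
  exact mul_le_mul_of_nonneg_right h2 (by positivity)

end Count

end

/-! ### Swapping rows to control structured kernel vectors. -/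

section

open scoped Classical
open Finset Matrix

variable {F : Type*} [Field F] [Fintype F]

omit [Fintype F] in
/-- Two independent families can be merged into one as large as the larger of them, keeping the
smaller one. -/
theorem exists_linearIndependent_sumElim {V ι : Type*} [AddCommGroup V] [Module F V] [Fintype ι]
    {r : ℕ} {Y : Fin r → V} {A : ι → V} (hY : LinearIndependent F Y)
    (hA : LinearIndependent F A) (hr : r ≤ Fintype.card ι) :
    ∃ B : Finset ι, #B = Fintype.card ι - r ∧
      LinearIndependent F (Sum.elim Y fun i : {i // i ∈ B} => A i) := by
  let v : Fin r ⊕ ι → V := Sum.elim Y A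
  have hs : LinearIndepOn F v (Set.range Sum.inl) := by
    rw [linearIndepOn_range_iff Sum.inl_injective]
    exact hY
  -- Steinitz exchange: `Y` is extended by members of `A` to a maximal independent subfamily, which
  -- has at least `card ι` members.
  obtain ⟨b, -, hsb, hspan, hb⟩ := exists_linearIndepOn_extension hs (Set.subset_univ _)
  have hcard : Fintype.card ι ≤ #b.toFinset := by
    have h1 : Submodule.span F (Set.range A) ≤ Submodule.span F (v '' b) := by
      rw [Submodule.span_le]
      rintro _ ⟨i, rfl⟩
      exact hspan ⟨Sum.inr i, trivial, rfl⟩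
    have hfin : Module.Finite F (Submodule.span F (v '' b)) :=
      Module.Finite.span_of_finite F (Set.toFinite _)
    have h2 := Submodule.finrank_mono h1
    rw [finrank_span_eq_card hA] at h2
    refine h2.trans ?_
    have h3 : v '' b = Set.range fun x : b => v x := Set.image_eq_range v b
    rw [h3, finrank_span_eq_card hb, Set.toFinset_card]
  have hsplit : #b.toFinset = r + #(univ.filter fun i : ι => Sum.inr i ∈ b) := by
    have : b.toFinset = univ.disjSum (univ.filter fun i : ι => Sum.inr i ∈ b) := by
      ext x
      cases x with
      | inl a => simpa using hsb ⟨a, rfl⟩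
      | inr i => simp
    rw [this, card_disjSum, card_univ, Fintype.card_fin]
  obtain ⟨B, hB, hBc⟩ := exists_subset_card_eq
    (show Fintype.card ι - r ≤ #(univ.filter fun i : ι => Sum.inr i ∈ b) by omega)
  refine ⟨B, hBc, ?_⟩
  let g : Fin r ⊕ {i // i ∈ B} → b := Sum.elim (fun a => ⟨Sum.inl a, hsb ⟨a, rfl⟩⟩)
    fun i => ⟨Sum.inr i, (mem_filter.1 (hB i.2)).2⟩
  have hg : Function.Injective g := by
    rintro (a | i) (a' | i') h
    · exact congrArg Sum.inl (Sum.inl_injective (congrArg Subtype.val h))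
    · exact absurd (congrArg Subtype.val h) Sum.inl_ne_inr
    · exact absurd (congrArg Subtype.val h) Sum.inr_ne_inl
    · exact congrArg Sum.inr (Subtype.ext (Sum.inr_injective (congrArg Subtype.val h)))
  convert hb.comp g hg using 1
  ext x
  cases x <;> rfl

variable {n : ℕ}

/-- Add the rows one by one: a new row is orthogonal to `w` with probability at least `a + c^{n-r}`,
and lies in the span of the fewer than `r` earlier ones with probability at most `c^{n-r}`. -/
theorem pow_le_pr_linearIndependent {y : Fin n → F → ℝ} (hy : ∀ j, IsProb (y j)) {c : ℝ}
    (hc0 : 0 ≤ c) (hc1 : c ≤ 1) (hc : ∀ j x, y j x ≤ c) {w : Fin n → F} {r : ℕ} {a : ℝ}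
    (ha : 0 ≤ a) (haw : a + c ^ (n - r) ≤ pr (prodWeight y) (fun x => x ⬝ᵥ w = 0)) {s : ℕ}
    (hs : s ≤ r) :
    a ^ s ≤ pr (prodWeight fun _ : Fin s => prodWeight y)
      (fun Y => LinearIndependent F Y ∧ ∀ i, Y i ⬝ᵥ w = 0) := by
  have hy' := isProb_prodWeight hy
  induction s with
  | zero =>
    rw [pow_zero, pr_congr (T := fun _ => True), pr_true (isProb_prodWeight fun _ => hy')]
    intro Y
    simp
  | succ s ih =>
    rw [pr_prodWeight_succ, pow_succ]
    refine (mul_le_mul_of_nonneg_right (ih (by omega)) ha).trans ?_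
    rw [pr, sum_mul]
    refine sum_le_sum fun Y _ => ?_
    rw [mul_assoc]
    refine mul_le_mul_of_nonneg_left ?_ ((isProb_prodWeight fun _ => hy').nonneg _)
    split_ifs with hY
    · rw [one_mul]
      have h1 := pr_sub_le hy'.nonneg (S := fun x => x ⬝ᵥ w = 0)
        (T := fun x => x ∈ Submodule.span F (Set.range Y))
      have h2 := pr_mem_submodule_le hy hc0 hc1 hc (Submodule.span F (Set.range Y))
      rw [finrank_span_eq_card hY.1, Fintype.card_fin] at h2
      have h3 : c ^ (n - s) ≤ c ^ (n - r) := pow_le_pow_of_le_one hc0 hc1 (by omega)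
      refine le_trans ?_ (h1.trans (pr_mono hy'.nonneg fun x hx => ?_))
      · linarith
      · rw [linearIndependent_finCons]
        refine ⟨⟨hY.1, hx.2⟩, fun i => ?_⟩
        refine Fin.cases ?_ (fun i => ?_) i
        · simpa using hx.1
        · simpa using hY.2 i
    · rw [zero_mul]
      exact pr_nonneg hy'.nonneg

variable {ι : Type*} [Fintype ι] [DecidableEq ι]

/-- Replacing `r` of the rows by independent copies of another random row. -/
theorem pr_mul_pr_le_sum {p : ι → Fin n → F → ℝ} {y : Fin n → F → ℝ}
    (hp : ∀ i j, IsProb (p i j)) (hy : ∀ j, IsProb (y j)) {r : ℕ} (hr : r ≤ Fintype.card ι)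
    {w : Fin n → F} {e : ℝ} (he : ∀ i, pr (prodWeight (p i)) (fun x => x ⬝ᵥ w = 0) ≤ e) :
    pr (prodWeight fun i => prodWeight (p i))
        (fun A => LinearIndependent F A ∧ ∀ i, A i ⬝ᵥ w = 0) *
      pr (prodWeight fun _ : Fin r => prodWeight y)
        (fun Y => LinearIndependent F Y ∧ ∀ i, Y i ⬝ᵥ w = 0) ≤
    ∑ B ∈ powersetCard (Fintype.card ι - r) (univ : Finset ι),
      (∑ Y, (prodWeight fun _ : Fin r => prodWeight y) Y *
        pr (prodWeight fun i : {i // i ∈ B} => prodWeight (p i))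
          (fun a => LinearIndependent F (Sum.elim Y a) ∧ w ∈ kerRows (Sum.elim Y a))) *
        e ^ r := by
  have hR : ∀ i, IsProb (prodWeight (p i)) := fun i => isProb_prodWeight (hp i)
  have hW := isProb_prodWeight (p := fun i => prodWeight (p i)) hR
  have hWY : IsProb (prodWeight fun _ : Fin r => prodWeight y) :=
    isProb_prodWeight fun _ => isProb_prodWeight hy
  simp_rw [sum_mul]
  rw [sum_comm, mul_comm]
  nth_rewrite 1 [pr]
  rw [sum_mul]
  refine sum_le_sum fun Y _ => ?_
  simp_rw [mul_assoc]
  rw [← mul_sum]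
  refine mul_le_mul_of_nonneg_left ?_ (hWY.nonneg Y)
  split_ifs with hY
  · rw [one_mul]
    -- The exchange lemma keeps the rows in `B`. Of the `r` discarded rows only orthogonality to `w`
    -- is remembered, each costing a factor `e`.
    have h1 : pr (prodWeight fun i => prodWeight (p i))
        (fun A => LinearIndependent F A ∧ ∀ i, A i ⬝ᵥ w = 0) ≤
      pr (prodWeight fun i => prodWeight (p i))
        (fun A => ∃ B ∈ powersetCard (Fintype.card ι - r) univ,
          (LinearIndependent F (Sum.elim Y fun i : {i // i ∈ B} => A i) ∧
            w ∈ kerRows (Sum.elim Y fun i : {i // i ∈ B} => A i)) ∧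
          ∀ i, i ∉ B → A i ⬝ᵥ w = 0) := by
      refine pr_mono hW.nonneg fun A hA => ?_
      obtain ⟨B, hB, hli⟩ := exists_linearIndependent_sumElim hY.1 hA.1 hr
      refine ⟨B, mem_powersetCard.2 ⟨subset_univ _, hB⟩, ⟨hli, mem_kerRows.2 ?_⟩,
        fun i _ => hA.2 i⟩
      rintro (i | i)
      · exact hY.2 i
      · exact hA.2 i
    refine h1.trans ((pr_exists_le hW.nonneg _ _).trans (sum_le_sum fun B hB => ?_))
    have h2 := pr_and_forall_notMem_le hR B
      (fun a => LinearIndependent F (Sum.elim Y a) ∧ w ∈ kerRows (Sum.elim Y a))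
      (fun _ x => x ⬝ᵥ w = 0) fun _ i => he i
    have h3 : Fintype.card ι - #B = r := by
      rw [(mem_powersetCard.1 hB).2]; omega
    rwa [h3] at h2
  · rw [zero_mul]
    have he0 : 0 ≤ e ^ r := by
      rcases Nat.eq_zero_or_pos r with rfl | h
      · simp
      · obtain ⟨i⟩ : Nonempty ι := Fintype.card_pos_iff.1 (by omega)
        exact pow_nonneg ((pr_nonneg (hR i).nonneg).trans (he i)) r
    exact sum_nonneg fun B _ => mul_nonneg
      (pr_nonneg (isProb_prodWeight fun i : {i // i ∈ B} => hR i).nonneg) he0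

/-- The expected number of kernel vectors which are much more structured for the rows than for the
row with entries `y`. -/
theorem sum_pr_structured_le {p : ι → Fin n → F → ℝ} {y : Fin n → F → ℝ}
    (hp : ∀ i j, IsProb (p i j)) (hy : ∀ j, IsProb (y j)) {c : ℝ}
    (hc0 : 0 ≤ c) (hc1 : c ≤ 1) (hc : ∀ j x, y j x ≤ c) {r : ℕ} (hr : r ≤ Fintype.card ι)
    (T : Finset (Fin n → F)) {θ : ℝ} (hθ : 0 ≤ θ) (a : (Fin n → F) → ℝ)
    (ha : ∀ w ∈ T, 0 < a w)
    (haw : ∀ w ∈ T, a w + c ^ (n - r) ≤ pr (prodWeight y) (fun x => x ⬝ᵥ w = 0))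
    (hθa : ∀ w ∈ T, ∀ i, pr (prodWeight (p i)) (fun x => x ⬝ᵥ w = 0) ≤ θ * a w) :
    ∑ w ∈ T, pr (prodWeight fun i => prodWeight (p i))
        (fun A => LinearIndependent F A ∧ ∀ i, A i ⬝ᵥ w = 0) ≤
      (Fintype.card ι).choose r * θ ^ r * (Fintype.card F : ℝ) ^ (n - Fintype.card ι) := by
  have hWY : IsProb (prodWeight fun _ : Fin r => prodWeight y) :=
    isProb_prodWeight fun _ => isProb_prodWeight hy
  have hWB : ∀ B : Finset ι, IsProb (prodWeight fun i : {i // i ∈ B} => prodWeight (p i)) :=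
    fun B => isProb_prodWeight fun i => isProb_prodWeight (hp i)
  set N : Finset ι → (Fin n → F) → ℝ := fun B w =>
    ∑ Y, (prodWeight fun _ : Fin r => prodWeight y) Y *
        pr (prodWeight fun i : {i // i ∈ B} => prodWeight (p i))
          (fun a => LinearIndependent F (Sum.elim Y a) ∧ w ∈ kerRows (Sum.elim Y a)) with hN
  have h1 : ∀ w ∈ T, pr (prodWeight fun i => prodWeight (p i))
      (fun A => LinearIndependent F A ∧ ∀ i, A i ⬝ᵥ w = 0) ≤
        ∑ B ∈ powersetCard (Fintype.card ι - r) (univ : Finset ι), θ ^ r * N B w := by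
    intro w hw
    have h2 := pr_mul_pr_le_sum hp hy hr (hθa w hw)
    have h3 := pow_le_pr_linearIndependent hy hc0 hc1 hc (ha w hw).le (haw w hw) le_rfl
    have hpos : 0 < a w ^ r := pow_pos (ha w hw) r
    refine le_of_mul_le_mul_right ?_ hpos
    refine (mul_le_mul_of_nonneg_left h3 (pr_nonneg
      (isProb_prodWeight fun i => isProb_prodWeight (hp i)).nonneg)).trans (h2.trans_eq ?_)
    rw [sum_mul]
    refine sum_congr rfl fun B _ => ?_
    rw [mul_pow]
    ring
  -- After the swap there are again `card ι` rows, and on the event they are independent, so their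
  -- kernel has exactly `q^{n - card ι}` elements. The vectors in `T` therefore never need to be
  -- counted in advance.
  have h4 : ∀ B ∈ powersetCard (Fintype.card ι - r) (univ : Finset ι),
      ∑ w ∈ T, N B w ≤ (Fintype.card F : ℝ) ^ (n - Fintype.card ι) := by
    intro B hB
    rw [hN, sum_comm]
    simp_rw [← mul_sum]
    have h5 : ∀ Y : Fin r → Fin n → F, ∑ w ∈ T,
        pr (prodWeight fun i : {i // i ∈ B} => prodWeight (p i))
          (fun a => LinearIndependent F (Sum.elim Y a) ∧ w ∈ kerRows (Sum.elim Y a)) ≤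
        (Fintype.card F : ℝ) ^ (n - Fintype.card ι) := by
      intro Y
      unfold pr
      rw [sum_comm]
      simp_rw [← mul_sum]
      refine (sum_le_sum (g := fun b => (prodWeight fun i : {i // i ∈ B} => prodWeight (p i)) b *
        (Fintype.card F : ℝ) ^ (n - Fintype.card ι)) fun b _ =>
          mul_le_mul_of_nonneg_left ?_ ((hWB B).nonneg b)).trans_eq ?_
      · by_cases hb : LinearIndependent F (Sum.elim Y b)
        · have h7 := card_kerRows hb
          have h8 : #{w ∈ T | w ∈ kerRows (Sum.elim Y b)} ≤ #(kerRows (Sum.elim Y b)) :=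
            card_le_card fun w hw => (mem_filter.1 hw).2
          have h9 : n - Fintype.card (Fin r ⊕ {i // i ∈ B}) = n - Fintype.card ι := by
            rw [Fintype.card_sum, Fintype.card_fin, Fintype.card_coe, (mem_powersetCard.1 hB).2]
            omega
          rw [h7, Fintype.card_fin, h9] at h8
          refine (sum_le_sum (g := fun w => if w ∈ kerRows (Sum.elim Y b) then (1 : ℝ) else 0)
            fun w _ => ?_).trans ?_
          · by_cases hw : w ∈ kerRows (Sum.elim Y b)
            · rw [if_pos ⟨hb, hw⟩, if_pos hw]
            · rw [if_neg fun h => hw h.2, if_neg hw]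
          · rw [sum_boole]
            exact_mod_cast h8
        · refine (sum_nonpos fun w _ => ?_).trans (by positivity)
          rw [if_neg fun h => hb h.1]
      rw [← sum_mul, (hWB B).sum_eq, one_mul]
    refine (sum_le_sum fun Y _ => mul_le_mul_of_nonneg_left (h5 Y) (hWY.nonneg Y)).trans_eq ?_
    rw [← sum_mul, hWY.sum_eq, one_mul]
  refine (sum_le_sum h1).trans ?_
  rw [sum_comm]
  simp_rw [← mul_sum]
  refine (mul_le_mul_of_nonneg_left (sum_le_sum h4) (by positivity)).trans_eq ?_
  rw [sum_const, card_powersetCard, card_univ, nsmul_eq_mul, Nat.choose_symm hr]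
  ring

end

/-! ### Splitting the span error by the type of kernel vector. -/

section

open scoped Classical
open Finset Matrix

variable {F : Type*} [Field F] [Fintype F] {n k : ℕ} {ψ : AddChar F ℂ} {α : ℝ}

/-- The indicator of a proposition, as a real number. -/
noncomputable def ind (P : Prop) : ℝ := if P then 1 else 0

theorem ind_of {P : Prop} (h : P) : ind P = 1 := if_pos h

theorem ind_of_not {P : Prop} (h : ¬ P) : ind P = 0 := if_neg h

theorem ind_nonneg (P : Prop) : 0 ≤ ind P := by unfold ind; split_ifs <;> norm_num

theorem sum_ind {X : Type*} (U : Finset X) (P : X → Prop) : ∑ w ∈ U, ind (P w) = #{w ∈ U | P w} := by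
  unfold ind; rw [sum_boole]

theorem pr_eq_sum_ind {Ω : Type*} [Fintype Ω] (w : Ω → ℝ) (S : Ω → Prop) :
    pr w S = ∑ a, w a * ind (S a) := rfl

theorem sum_pr_eq {Ω X : Type*} [Fintype Ω] (w : Ω → ℝ) (U : Finset X) (S : X → Ω → Prop) :
    ∑ x ∈ U, pr w (S x) = ∑ a, w a * ∑ x ∈ U, ind (S x a) := by
  simp_rw [pr_eq_sum_ind, mul_sum]
  rw [sum_comm]

/-- The expected error, over the event that the rows are independent, when the probability that a
further row lies in their span is replaced by its value for a uniform row. -/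
noncomputable def spanError (p : Fin k → Fin n → F → ℝ) (p' : Fin n → F → ℝ) : ℝ :=
  ∑ A, prodWeight (fun i => prodWeight (p i)) A * (ind (LinearIndependent F A) *
    |pr (prodWeight p') (fun x => x ∈ Submodule.span F (Set.range A)) -
      ((Fintype.card F : ℝ) ^ (n - k))⁻¹|)

theorem two_le_card_field : (2 : ℝ) ≤ Fintype.card F := mod_cast Fintype.one_lt_card

theorem inv_card_pow_le_one (d : ℕ) : ((Fintype.card F : ℝ) ^ d)⁻¹ ≤ 1 :=
  inv_le_one_of_one_le₀ (one_le_pow₀ (by linarith [two_le_card_field (F := F)]))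

theorem spanError_le_of_forall {p : Fin k → Fin n → F → ℝ} {p' : Fin n → F → ℝ}
    (hp : ∀ i j, IsProb (p i j)) {e : ℝ} (he : 0 ≤ e)
    (h : ∀ A : Fin k → Fin n → F, LinearIndependent F A →
      |pr (prodWeight p') (fun x => x ∈ Submodule.span F (Set.range A)) -
        ((Fintype.card F : ℝ) ^ (n - k))⁻¹| ≤ e) :
    spanError p p' ≤ e := by
  have hW := isProb_prodWeight fun i => isProb_prodWeight (hp i)
  refine (sum_le_sum (g := fun A => prodWeight (fun i => prodWeight (p i)) A * e) fun A _ =>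
    mul_le_mul_of_nonneg_left ?_ (hW.nonneg A)).trans_eq ?_
  · by_cases hA : LinearIndependent F A
    · rw [ind_of hA, one_mul]; exact h A hA
    · rw [ind_of_not hA, zero_mul]; exact he
  · rw [← sum_mul, hW.sum_eq, one_mul]

theorem spanError_le_of_codim {p : Fin k → Fin n → F → ℝ} {p' : Fin n → F → ℝ}
    (hp : ∀ i j, IsProb (p i j)) (hp' : ∀ j, IsProb (p' j))
    (hα : ∀ j, BalancedWeight α (p' j)) (hα0 : 0 ≤ α) (hα1 : α ≤ 1)
    (hd : n ≤ 200 * (n - k)) :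
    spanError p p' ≤ Real.exp (-(α * n / 400)) := by
  refine spanError_le_of_forall hp (Real.exp_nonneg _) fun A hA => ?_
  have h1 := pr_mem_submodule_le hp' (by linarith) (by linarith)
    (fun j x => (hα j).le_one_sub x) (Submodule.span F (Set.range A))
  rw [finrank_span_eq_card hA, Fintype.card_fin] at h1
  have h0 := pr_nonneg (S := fun x => x ∈ Submodule.span F (Set.range A))
    (isProb_prodWeight hp').nonneg
  have hd' : (n : ℝ) ≤ 200 * ((n - k : ℕ) : ℝ) := mod_cast hd
  have hn0 : (0 : ℝ) ≤ n := Nat.cast_nonneg n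
  have h2 : (1 - α) ^ (n - k) ≤ Real.exp (-(α * n / 400)) := by
    refine (pow_le_pow_left₀ (by linarith) (Real.one_sub_le_exp_neg α) _).trans ?_
    rw [← Real.exp_nat_mul, Real.exp_le_exp]
    nlinarith
  have h3 : ((Fintype.card F : ℝ) ^ (n - k))⁻¹ ≤ Real.exp (-(α * n / 400)) := by
    rw [← inv_pow]
    have h4 : (Fintype.card F : ℝ)⁻¹ ≤ Real.exp (-(1 / 2)) := by
      have := inv_card_le_half (F := F)
      have := Real.one_sub_le_exp_neg (1 / 2)
      linarith
    refine (pow_le_pow_left₀ (by positivity) h4 _).trans ?_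
    rw [← Real.exp_nat_mul, Real.exp_le_exp]
    nlinarith
  have h5 : 0 ≤ ((Fintype.card F : ℝ) ^ (n - k))⁻¹ := by positivity
  rw [abs_le]
  constructor <;> linarith

/-- Some nonzero vector with support of size at most `m` is orthogonal to all rows. -/
def SparseKernel (m : ℕ) (A : Fin k → Fin n → F) : Prop :=
  ∃ w, w ≠ 0 ∧ #(supp w) ≤ m ∧ ∀ i, A i ⬝ᵥ w = 0

/-- The vectors which are unstructured for the rows `μ (σ i)` but not negligible for `μ i'`. -/
noncomputable def unstructured (ψ : AddChar F ℂ) (μ : Fin n → Fin n → F → ℝ) (σ : Fin k → Fin n)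
    (i' : Fin n) (ε : ℝ) : Finset (Fin n → F) :=
  {w | ε ≤ rho ψ (μ i') w ∧ ∀ i, rho ψ (μ (σ i)) w ≤ 1 / 10 * (Fintype.card F : ℝ)⁻¹}

/-- The dense vectors which are structured, most of all for the row `μ s`. -/
noncomputable def structured (ψ : AddChar F ℂ) (μ : Fin n → Fin n → F → ℝ) (m : ℕ) (ε : ℝ)
    (s : Fin n) : Finset (Fin n → F) :=
  {w | m < #(supp w) ∧ ε ≤ rho ψ (μ s) w ∧
    1 / 10 * (Fintype.card F : ℝ)⁻¹ ≤ rho ψ (μ s) w ∧ ∀ i, rho ψ (μ i) w ≤ rho ψ (μ s) w}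

/-- If `w` is neither negligible for `i'` nor unstructured, some exposed row has `rho` above
`1/(10q)`. The row `s` maximising `rho` over all `n` rows then inherits both lower bounds. -/
theorem rho_le_of_dense {μ : Fin n → Fin n → F → ℝ} (hμ : ∀ i j, IsProb (μ i j))
    (σ : Fin k → Fin n) (i' : Fin n) {m : ℕ} {ε : ℝ} (hε : 0 ≤ ε) {w : Fin n → F}
    (hw : m < #(supp w)) :
    rho ψ (μ i') w ≤ ε + (ind (w ∈ unstructured ψ μ σ i' ε) +
      ∑ s, ind (w ∈ structured ψ μ m ε s)) := by
  have hrho1 : rho ψ (μ i') w ≤ 1 := rho_le_one (hμ i')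
  have hs0 : 0 ≤ ∑ s, ind (w ∈ structured ψ μ m ε s) := sum_nonneg fun _ _ => ind_nonneg _
  have hc0 := ind_nonneg (w ∈ unstructured ψ μ σ i' ε)
  by_cases h3 : rho ψ (μ i') w ≤ ε
  · linarith
  push Not at h3
  by_cases h4 : w ∈ unstructured ψ μ σ i' ε
  · rw [ind_of h4]
    linarith
  obtain ⟨s, -, hs⟩ := exists_max_image univ (fun i => rho ψ (μ i) w) ⟨i', mem_univ _⟩
  have h5 : w ∈ structured ψ μ m ε s := by
    rw [unstructured, mem_filter] at h4
    push Not at h4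
    obtain ⟨i, hi⟩ := h4 (mem_univ _) h3.le
    rw [structured, mem_filter]
    exact ⟨mem_univ _, hw, h3.le.trans (hs _ (mem_univ _)),
      hi.le.trans (hs _ (mem_univ _)), fun i => hs i (mem_univ _)⟩
  have h6 := single_le_sum (f := fun s => ind (w ∈ structured ψ μ m ε s))
    (fun _ _ => ind_nonneg _) (mem_univ s)
  simp only [ind_of h5] at h6
  linarith

theorem ind_mul_abs_le {μ : Fin n → Fin n → F → ℝ} (hψ : ψ.IsPrimitive)
    (hμ : ∀ i j, IsProb (μ i j)) (σ : Fin k → Fin n) (i' : Fin n) (m : ℕ) {ε : ℝ} (hε : 0 ≤ ε)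
    (A : Fin k → Fin n → F) :
    ind (LinearIndependent F A) *
      |pr (prodWeight (μ i')) (fun x => x ∈ Submodule.span F (Set.range A)) -
        ((Fintype.card F : ℝ) ^ (n - k))⁻¹| ≤
      ind (SparseKernel m A) + 2 * (ε + ((Fintype.card F : ℝ) ^ (n - k))⁻¹ *
        (∑ w ∈ unstructured ψ μ σ i' ε, ind (∀ i, A i ⬝ᵥ w = 0) +
          ∑ s, ∑ w ∈ structured ψ μ m ε s,
            ind (LinearIndependent F A ∧ ∀ i, A i ⬝ᵥ w = 0))) := by
  set Q : ℝ := ((Fintype.card F : ℝ) ^ (n - k))⁻¹ with hQ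
  have hQ0 : 0 ≤ Q := by positivity
  set C := unstructured ψ μ σ i' ε
  set T := structured ψ μ m ε
  set X := ∑ w ∈ C, ind (∀ i, A i ⬝ᵥ w = 0)
  set Z := ∑ s, ∑ w ∈ T s, ind (LinearIndependent F A ∧ ∀ i, A i ⬝ᵥ w = 0)
  have hX0 : 0 ≤ X := sum_nonneg fun _ _ => ind_nonneg _
  have hZ0 : 0 ≤ Z := sum_nonneg fun _ _ => sum_nonneg fun _ _ => ind_nonneg _
  have hrest : 0 ≤ 2 * (ε + Q * (X + Z)) := by positivity
  by_cases hA : LinearIndependent F A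
  swap
  · rw [ind_of_not hA, zero_mul]
    exact add_nonneg (ind_nonneg _) hrest
  rw [ind_of hA, one_mul]
  by_cases hsp : SparseKernel m A
  · rw [ind_of hsp]
    have h1 := pr_nonneg (S := fun x => x ∈ Submodule.span F (Set.range A))
      (isProb_prodWeight (hμ i')).nonneg
    have h2 := pr_le_one (S := fun x => x ∈ Submodule.span F (Set.range A))
      (isProb_prodWeight (hμ i'))
    have h3 : Q ≤ 1 := inv_card_pow_le_one _
    have : |pr (prodWeight (μ i')) (fun x => x ∈ Submodule.span F (Set.range A)) - Q| ≤ 1 := by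
      rw [abs_le]; constructor <;> linarith
    linarith
  rw [ind_of_not hsp, zero_add]
  have h1 := abs_pr_mem_span_sub_le (p := μ i') hψ (hμ i') hA
  rw [Fintype.card_fin, Fintype.card_fin] at h1
  refine h1.trans ((mul_le_mul_of_nonneg_left sum_kerRows_le_two_mul_rho hQ0).trans ?_)
  set D := (kerRows A).filter fun w => w ≠ 0 with hD
  have h2 : ∀ w ∈ D, rho ψ (μ i') w ≤ ε + (ind (w ∈ C) + ∑ s, ind (w ∈ T s)) := by
    intro w hw
    obtain ⟨hw1, hw0⟩ := mem_filter.1 hw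
    refine rho_le_of_dense hμ σ i' hε (not_le.1 fun h6 => hsp ⟨w, hw0, h6, mem_kerRows.1 hw1⟩)
  have hcount : ∀ (U : Finset (Fin n → F)) (P : (Fin n → F) → Prop),
      (∀ w, w ∈ kerRows A → P w) → ∑ w ∈ D, ind (w ∈ U) ≤ ∑ w ∈ U, ind (P w) := by
    intro U P hP
    rw [sum_ind, sum_ind]
    exact_mod_cast card_le_card fun w hw => by
      simp only [hD, mem_filter] at hw ⊢
      exact ⟨hw.2, hP w hw.1.1⟩
  have h3 := sum_le_sum h2
  rw [sum_add_distrib, sum_add_distrib, sum_const, nsmul_eq_mul, sum_comm (t := univ)] at h3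
  have h4 : ∑ w ∈ D, ind (w ∈ C) ≤ X := hcount C _ fun w hw => mem_kerRows.1 hw
  have h5 : ∑ s, ∑ w ∈ D, ind (w ∈ T s) ≤ Z :=
    sum_le_sum fun s _ => hcount (T s) _ fun w hw => ⟨hA, mem_kerRows.1 hw⟩
  -- The kernel has exactly `Q⁻¹` elements, so negligible vectors contribute at most `ε` on average.
  have h6 : Q * (#D * ε) ≤ ε := by
    have h7 : (#D : ℝ) ≤ #(kerRows A) := mod_cast card_filter_le _ _
    have h8 := card_kerRows hA
    rw [Fintype.card_fin, Fintype.card_fin] at h8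
    rw [h8, Nat.cast_pow] at h7
    rw [← mul_assoc]
    refine mul_le_of_le_one_left hε ?_
    rw [hQ, inv_mul_le_one₀ (by have := card_field_pos (F := F); positivity)]
    exact h7
  have h9 : Q * ∑ w ∈ D, rho ψ (μ i') w ≤ Q * (#D * ε + (X + Z)) :=
    mul_le_mul_of_nonneg_left (by linarith) hQ0
  rw [mul_add] at h9
  rw [mul_left_comm]
  linarith

/-- The decomposition of the error according to the structure of the kernel vectors. -/
theorem spanError_le {μ : Fin n → Fin n → F → ℝ} (hψ : ψ.IsPrimitive)
    (hμ : ∀ i j, IsProb (μ i j)) (σ : Fin k → Fin n) (i' : Fin n) (m : ℕ) {ε : ℝ} (hε : 0 ≤ ε) :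
    spanError (fun i => μ (σ i)) (μ i') ≤
      pr (prodWeight fun i => prodWeight (μ (σ i))) (SparseKernel m) +
      2 * (ε + ((Fintype.card F : ℝ) ^ (n - k))⁻¹ *
        (∑ w ∈ unstructured ψ μ σ i' ε,
            pr (prodWeight fun i => prodWeight (μ (σ i))) (fun A => ∀ i, A i ⬝ᵥ w = 0) +
          ∑ s, ∑ w ∈ structured ψ μ m ε s,
            pr (prodWeight fun i => prodWeight (μ (σ i)))
              (fun A => LinearIndependent F A ∧ ∀ i, A i ⬝ᵥ w = 0))) := by
  have hW : IsProb (prodWeight fun i : Fin k => prodWeight (μ (σ i))) :=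
    isProb_prodWeight fun i => isProb_prodWeight (hμ (σ i))
  refine (sum_le_sum fun A _ => mul_le_mul_of_nonneg_left
    (ind_mul_abs_le hψ hμ σ i' m hε A) (hW.nonneg A)).trans_eq ?_
  simp_rw [sum_pr_eq, mul_add, sum_add_distrib]
  rw [pr_eq_sum_ind]
  have e1 : ∑ A, prodWeight (fun i : Fin k => prodWeight (μ (σ i))) A * (2 * ε) = 2 * ε := by
    rw [← sum_mul, hW.sum_eq, one_mul]
  rw [e1]
  congr 2
  rw [sum_comm' (t' := univ) (s' := fun _ => univ) (by simp)]
  simp only [mul_sum]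
  congr 1
  · exact sum_congr rfl fun _ _ => sum_congr rfl fun _ _ => by ring
  · exact sum_congr rfl fun _ _ => sum_congr rfl fun _ _ => sum_congr rfl fun _ _ => by ring

end

/-! ### Quantitative bounds for each type of kernel vector. -/

section

open scoped Classical
open Finset Matrix

variable {F : Type*} [Field F] [Fintype F] {n k : ℕ} {ψ : AddChar F ℂ} {α : ℝ}

/-- One term of the binomial expansion of `(1 + 1/128)^n`, with `128^s ≤ e^{7s}`; the rate is `1/128
+ 7/200 < 43/1000`. -/
theorem choose_le_exp {s : ℕ} (hs : 200 * s ≤ n) :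
    (n.choose s : ℝ) ≤ Real.exp (43 / 1000 * n) := by
  have hsn : s ≤ n := by omega
  have h1 : (n.choose s : ℝ) * (1 / 128) ^ s ≤ (1 + 1 / 128) ^ n := by
    rw [add_comm, add_pow]
    have := single_le_sum (f := fun m => (1 / 128 : ℝ) ^ m * 1 ^ (n - m) * (n.choose m))
      (fun _ _ => by positivity) (mem_range.2 (Nat.lt_succ_of_le hsn))
    refine le_trans (le_of_eq ?_) this
    simp only [one_pow, mul_one]
    ring
  have h2 : (1 + 1 / 128 : ℝ) ^ n ≤ Real.exp (1 / 128 * n) := by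
    rw [mul_comm, Real.exp_nat_mul]
    refine pow_le_pow_left₀ (by norm_num) ?_ n
    rw [add_comm]
    exact Real.add_one_le_exp _
  have h3 : (128 : ℝ) ^ s ≤ Real.exp (7 / 200 * n) := by
    have h4 : (128 : ℝ) ≤ Real.exp 7 := by
      have h5 : Real.exp 7 = Real.exp 1 ^ 7 := by rw [← Real.exp_nat_mul]; norm_num
      have h6 : (2 : ℝ) ^ 7 ≤ Real.exp 1 ^ 7 :=
        pow_le_pow_left₀ (by norm_num) (by linarith [Real.exp_one_gt_d9]) 7
      rw [h5]
      linarith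
    refine (pow_le_pow_left₀ (by norm_num) h4 s).trans ?_
    rw [← Real.exp_nat_mul, Real.exp_le_exp]
    have : (200 : ℝ) * s ≤ n := mod_cast hs
    linarith
  have h7 : (n.choose s : ℝ) = (n.choose s : ℝ) * (1 / 128) ^ s * 128 ^ s := by
    rw [mul_assoc, ← mul_pow]; norm_num
  rw [h7]
  refine (mul_le_mul (h1.trans h2) h3 (by positivity) (Real.exp_nonneg _)).trans ?_
  rw [← Real.exp_add, Real.exp_le_exp]
  have : (0 : ℝ) ≤ n := Nat.cast_nonneg n
  linarith

theorem pr_dotProduct_le_one_sub {p : Fin n → F → ℝ} (hp : ∀ j, IsProb (p j))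
    (hα : ∀ j, BalancedWeight α (p j)) (hα0 : 0 ≤ α) (hα1 : α ≤ 1) {w : Fin n → F} (hw : w ≠ 0) :
    pr (prodWeight p) (fun x => x ⬝ᵥ w = 0) ≤ 1 - α := by
  let V : Submodule F (Fin n → F) := LinearMap.ker ((dotProductBilin F F).flip w)
  have hV : V ≠ ⊤ := by
    intro h
    obtain ⟨j, hj⟩ := Function.ne_iff.1 hw
    have h1 : Pi.single j 1 ∈ V := h ▸ Submodule.mem_top
    have h2 : (Pi.single j 1 : Fin n → F) ⬝ᵥ w = 0 := h1
    rw [single_one_dotProduct] at h2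
    exact hj h2
  have h1 := pr_mem_submodule_le hp (by linarith) (by linarith) (fun j x => (hα j).le_one_sub x) V
  have h2 : Module.finrank F V < n := by
    simpa using Submodule.finrank_lt hV
  have h3 : (1 - α) ^ (n - Module.finrank F V) ≤ (1 - α) ^ 1 :=
    pow_le_pow_of_le_one (by linarith) (by linarith) (by omega)
  rw [pow_one] at h3
  exact h1.trans h3

theorem pr_sparseKernel_le {μ : Fin n → Fin n → F → ℝ} (hψ : ψ.IsPrimitive)
    (hμ : ∀ i j, IsProb (μ i j)) (hα : ∀ i j, BalancedWeight α (μ i j)) (hα0 : 0 < α)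
    (hα1 : α ≤ 1) (hk : k ≤ n) (hd : 200 * (n - k) < n) (σ : Fin k → Fin n) :
    pr (prodWeight fun i => prodWeight (μ (σ i))) (SparseKernel (n / 200)) ≤
      n * ((n : ℝ) ^ (2 * ⌈24576 / α⌉₊) * Real.exp (-(α * n / 2)) + Real.exp (-(n / 10))) := by
  -- For supports of size at least `24576/α` the bound `3/4` beats the two binomials. Smaller
  -- supports have bounded size, so the binomials are polynomial in `n` and the weaker bound `1 - α`
  -- is enough.
  set c : ℕ → ℝ := fun s => if 24576 ≤ α * s then 3 / 4 else 1 - α with hc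
  have h1 := pr_exists_sparse_le (p := fun i => μ (σ i)) (m := n / 200) (c := c)
    (fun i => hμ (σ i)) (by rw [Fintype.card_fin]; omega) (fun i w hw1 _ => by
      have hw0 : w ≠ 0 := by rintro rfl; simp [supp] at hw1
      simp only [hc]
      split_ifs with hs
      · exact (pr_dotProduct_le hψ (hμ _)).trans (inv_card_add_rho_le hψ (hμ _) (hα _) hs)
      · exact pr_dotProduct_le_one_sub (hμ _) (hα _) hα0.le hα1 hw0)
  refine h1.trans ?_
  rw [Fintype.card_fin, Fintype.card_fin]
  have hn0 : (0 : ℝ) ≤ n := Nat.cast_nonneg n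
  have hterm : ∀ s ∈ Icc 1 (n / 200), (n.choose s : ℝ) * ((k.choose s : ℝ) * c s ^ (k - s)) ≤
      (n : ℝ) ^ (2 * ⌈24576 / α⌉₊) * Real.exp (-(α * n / 2)) + Real.exp (-(n / 10)) := by
    intro s hs
    obtain ⟨hs1, hs2⟩ := mem_Icc.1 hs
    have hks : (99 / 100 * n : ℝ) ≤ ((k - s : ℕ) : ℝ) := by
      have : 99 * n ≤ 100 * (k - s) := by omega
      have : (99 : ℝ) * n ≤ 100 * ((k - s : ℕ) : ℝ) := mod_cast this
      linarith
    have hchoose : (k.choose s : ℝ) ≤ n.choose s := mod_cast Nat.choose_le_choose s hk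
    have hc0 : 0 ≤ c s := by simp only [hc]; split_ifs <;> linarith
    have hbound : (n.choose s : ℝ) * ((k.choose s : ℝ) * c s ^ (k - s)) ≤
        (n.choose s : ℝ) ^ 2 * c s ^ (k - s) := by
      rw [sq, mul_assoc]
      exact mul_le_mul_of_nonneg_left (mul_le_mul_of_nonneg_right hchoose (by positivity))
        (Nat.cast_nonneg _)
    refine hbound.trans ?_
    have hA : 0 ≤ (n : ℝ) ^ (2 * ⌈24576 / α⌉₊) * Real.exp (-(α * n / 2)) := by positivity
    have hB : 0 ≤ Real.exp (-(n / 10 : ℝ)) := Real.exp_nonneg _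
    by_cases hcs : 24576 ≤ α * s
    · have h2 : c s = 3 / 4 := if_pos hcs
      rw [h2]
      refine le_trans ?_ (le_add_of_nonneg_left hA)
      have h3 : ((3 : ℝ) / 4) ^ (k - s) ≤ Real.exp (-(1 / 4 * (99 / 100 * n))) := by
        have h4 : (3 : ℝ) / 4 ≤ Real.exp (-(1 / 4)) := by
          linarith [Real.one_sub_le_exp_neg (1 / 4)]
        refine (pow_le_pow_left₀ (by norm_num) h4 _).trans ?_
        rw [← Real.exp_nat_mul, Real.exp_le_exp]
        linarith
      have h5 := pow_le_pow_left₀ (by positivity) (choose_le_exp (n := n) (s := s) (by omega)) 2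
      refine (mul_le_mul h5 h3 (by positivity) (by positivity)).trans ?_
      rw [← Real.exp_nat_mul, ← Real.exp_add, Real.exp_le_exp]
      push_cast
      linarith
    · have h2 : c s = 1 - α := if_neg hcs
      rw [h2]
      refine le_trans ?_ (le_add_of_nonneg_right hB)
      refine mul_le_mul ?_ ?_ (pow_nonneg (by linarith) _) (by positivity)
      · have h3 : (n.choose s : ℝ) ≤ (n : ℝ) ^ s := mod_cast Nat.choose_le_pow n s
        have hn1 : (1 : ℝ) ≤ n := by
          have : 1 ≤ n := by omega
          exact_mod_cast this
        have h4 : s ≤ ⌈24576 / α⌉₊ := by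
          have h5 : (s : ℝ) < 24576 / α := by
            rw [lt_div_iff₀ hα0]
            linarith [not_le.1 hcs]
          exact_mod_cast (h5.trans_le (Nat.le_ceil _)).le
        calc (n.choose s : ℝ) ^ 2 ≤ ((n : ℝ) ^ s) ^ 2 := pow_le_pow_left₀ (by positivity) h3 2
          _ = (n : ℝ) ^ (2 * s) := by rw [← pow_mul, mul_comm]
          _ ≤ _ := pow_le_pow_right₀ hn1 (by omega)
      · refine (pow_le_pow_left₀ (by linarith) (Real.one_sub_le_exp_neg α) _).trans ?_
        rw [← Real.exp_nat_mul, Real.exp_le_exp]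
        nlinarith
  refine (sum_le_sum hterm).trans ?_
  rw [sum_const, nsmul_eq_mul, Nat.card_Icc, Nat.add_sub_cancel]
  refine mul_le_mul_of_nonneg_right ?_ (by positivity)
  exact_mod_cast Nat.div_le_self n 200

/-- All powers of `q` cancel, leaving `ε^{-L} (3/4)^n (11/10)^k`. Since `3/4 * 11/10 = 1 - 0.175`,
this decays exponentially; `αL ≤ 24577` makes `ε^{-L}` at most `exp(n/100)`. -/
theorem sum_unstructured_le {μ : Fin n → Fin n → F → ℝ} (hψ : ψ.IsPrimitive)
    (hμ : ∀ i j, IsProb (μ i j)) (hα : ∀ i j, BalancedWeight α (μ i j)) (hα0 : 0 < α)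
    (hα1 : α ≤ 1) (hk : k ≤ n) (σ : Fin k → Fin n) (i' : Fin n) :
    ((Fintype.card F : ℝ) ^ (n - k))⁻¹ *
      ∑ w ∈ unstructured ψ μ σ i' (Real.exp (-(α * n / 2 ^ 80))),
        pr (prodWeight fun i => prodWeight (μ (σ i))) (fun A => ∀ i, A i ⬝ᵥ w = 0) ≤
      Real.exp (-(n / 10)) := by
  have hq := card_field_pos (F := F)
  set L := ⌈24576 / α⌉₊
  have hL : 24576 ≤ α * L := by
    have := Nat.le_ceil (24576 / α)
    rw [div_le_iff₀ hα0] at this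
    linarith
  have hL0 : L ≠ 0 := by
    rintro h
    rw [h] at hL
    norm_num at hL
  have hL1 : α * L ≤ 24577 := by
    have h1 := (Nat.ceil_lt_add_one (a := 24576 / α) (by positivity)).le
    have h2 := mul_le_mul_of_nonneg_left h1 hα0.le
    rw [mul_add, mul_div_cancel₀ _ hα0.ne'] at h2
    linarith
  have h1 := sum_pr_unstructured_le (p := fun i => μ (σ i)) (p' := μ i') hψ (fun i => hμ (σ i))
    (hμ i') (hα i') hL0 hL (Real.exp_pos (-(α * n / 2 ^ 80)))
    (C := unstructured ψ μ σ i' (Real.exp (-(α * n / 2 ^ 80)))) fun w hw => (mem_filter.1 hw).2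
  rw [Fintype.card_fin, Fintype.card_fin] at h1
  refine (mul_le_mul_of_nonneg_left h1
    (by positivity : 0 ≤ ((Fintype.card F : ℝ) ^ (n - k))⁻¹)).trans ?_
  have h2 : ((Fintype.card F : ℝ) ^ (n - k))⁻¹ * ((Real.exp (-(α * n / 2 ^ 80)) ^ L)⁻¹ *
      (3 / 4 * (Fintype.card F : ℝ)) ^ n * (11 / 10 * (Fintype.card F : ℝ)⁻¹) ^ k) =
      (Real.exp (-(α * n / 2 ^ 80)) ^ L)⁻¹ * ((3 / 4) ^ n * (11 / 10) ^ k) := by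
    rw [mul_pow, mul_pow, inv_pow]
    have : (Fintype.card F : ℝ) ^ n =
        (Fintype.card F : ℝ) ^ (n - k) * (Fintype.card F : ℝ) ^ k := by
      rw [← pow_add, Nat.sub_add_cancel hk]
    rw [this]
    field_simp
  rw [h2]
  have hn0 : (0 : ℝ) ≤ n := Nat.cast_nonneg n
  have h3 : (Real.exp (-(α * n / 2 ^ 80)) ^ L)⁻¹ ≤ Real.exp (1 / 100 * n) := by
    rw [← Real.exp_nat_mul, ← Real.exp_neg, Real.exp_le_exp]
    have : -((L : ℝ) * -(α * n / 2 ^ 80)) = (α * L) * n / 2 ^ 80 := by ring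
    rw [this, div_le_iff₀ (by positivity)]
    nlinarith
  have h4 : ((3 : ℝ) / 4) ^ n * (11 / 10) ^ k ≤ Real.exp (-(175 / 1000 * n)) := by
    have h5 : ((11 : ℝ) / 10) ^ k ≤ (11 / 10) ^ n := pow_le_pow_right₀ (by norm_num) hk
    refine (mul_le_mul_of_nonneg_left h5 (by positivity)).trans ?_
    rw [← mul_pow]
    have h6 : (3 : ℝ) / 4 * (11 / 10) ≤ Real.exp (-(175 / 1000)) := by
      linarith [Real.one_sub_le_exp_neg (175 / 1000)]
    refine (pow_le_pow_left₀ (by norm_num) h6 _).trans ?_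
    rw [← Real.exp_nat_mul, Real.exp_le_exp]
    linarith
  refine (mul_le_mul h3 h4 (by positivity) (Real.exp_nonneg _)).trans ?_
  rw [← Real.exp_add, Real.exp_le_exp]
  linarith

theorem sum_structured_le {μ : Fin n → Fin n → F → ℝ} (hψ : ψ.IsPrimitive)
    (hμ : ∀ i j, IsProb (μ i j)) (hα : ∀ i j, BalancedWeight α (μ i j)) (hα0 : 0 < α)
    (hα1 : α ≤ 1) (hk : k ≤ n) (hd : 200 * (n - k) < n) (hn : 2 ^ 74 ≤ α * n) (σ : Fin k → Fin n)
    (s : Fin n) :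
    ((Fintype.card F : ℝ) ^ (n - k))⁻¹ *
      ∑ w ∈ structured ψ μ (n / 200) (Real.exp (-(α * n / 2 ^ 80))) s,
        pr (prodWeight fun i => prodWeight (μ (σ i)))
          (fun A => LinearIndependent F A ∧ ∀ i, A i ⬝ᵥ w = 0) ≤
      Real.exp (-(n / 2)) := by
  have hq := card_field_pos (F := F)
  have hn0 : (0 : ℝ) ≤ n := Nat.cast_nonneg n
  have hn100 : 100 ≤ n := by
    have : (100 : ℝ) ≤ n := by nlinarith
    exact_mod_cast this
  set ε := Real.exp (-(α * n / 2 ^ 80)) with hε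
  set β : ℝ := ((16 : ℝ) ^ 16 * 4)⁻¹ with hβ
  have hβ' : β = 1 / 2 ^ 66 := by rw [hβ]; norm_num
  have hβ0 : 0 ≤ β := by positivity
  have hβ1 : β ≤ 1 / 2 := by rw [hβ']; norm_num
  have hβ2 : β ≤ 1 := hβ1.trans (by norm_num)
  have hβα : β * α ≤ 1 := mul_le_one₀ hβ2 hα0.le hα1
  have hβα0 : 0 ≤ β * α := mul_nonneg hβ0 hα0.le
  -- With 16 doublings and support above `n/200`, the exponent is at least about `αn/(200 * 2^65)`.
  -- The hypothesis `2^74 ≤ αn` leaves room for `αn/2^80` and an extra `1`, which pays for the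
  -- factor `1/2`.
  have herr : ∀ w : Fin n → F, n / 200 < #(supp w) →
      Real.exp (-(α * #(supp w) / (2 * 16 ^ 16))) ≤ ε / 2 := by
    intro w hw
    have h1 : (n : ℝ) ≤ 200 * #(supp w) := by
      have : n ≤ 200 * #(supp w) := by omega
      exact_mod_cast this
    have h2 : Real.exp (-(α * #(supp w) / (2 * 16 ^ 16))) ≤
        Real.exp (-(α * n / 2 ^ 80) + -1) := by
      rw [Real.exp_le_exp]
      have h3 : α * n ≤ 200 * (α * #(supp w)) := by nlinarith
      norm_num at hn ⊢
      linarith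
    refine h2.trans ?_
    rw [Real.exp_add, div_eq_mul_inv]
    refine mul_le_mul_of_nonneg_left ?_ (Real.exp_nonneg _)
    rw [Real.exp_neg]
    refine inv_anti₀ (by norm_num) ?_
    linarith [Real.exp_one_gt_d9]
  have hpow : (1 - β * α) ^ (n - n / 4) ≤ ε := by
    refine (pow_le_pow_left₀ (by linarith) (Real.one_sub_le_exp_neg _) _).trans ?_
    rw [← Real.exp_nat_mul, hε, Real.exp_le_exp]
    have h1 : (n : ℝ) ≤ 2 * ((n - n / 4 : ℕ) : ℝ) := by
      have : n ≤ 2 * (n - n / 4) := by omega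
      exact_mod_cast this
    have h2 : α * n ≤ 2 * (((n - n / 4 : ℕ) : ℝ) * α) := by nlinarith
    have h3 : ((n - n / 4 : ℕ) : ℝ) * -(β * α) = -(1 / 2 ^ 66 * (((n - n / 4 : ℕ) : ℝ) * α)) := by
      rw [hβ']; ring
    rw [h3]
    have h4 : 0 ≤ α * n := by positivity
    norm_num
    linarith
  -- As `ε ≤ rho`, the lazy walk has probability at least `2^15 * rho`, which covers `a w = 2^14 *
  -- rho` and the span loss `c^{n-r} ≤ ε`. As `1/q ≤ 10 * rho`, an original row has probability at
  -- most `11 * rho = θ * a w`. Then `θ ≤ 4^{-5}` and `r = n/4` beat the `2^n` choices of rows.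
  have h1 := sum_pr_structured_le (p := fun i => μ (σ i)) (y := fun j => lazyDiff β (μ s j))
    (c := 1 - β * α) (r := n / 4) (T := structured ψ μ (n / 200) ε s) (θ := 44 / 2 ^ 16)
    (a := fun w => 2 ^ 16 * rho ψ (μ s) w / 4)
    (fun i => hμ (σ i)) (fun j => isProb_lazyDiff (hμ s j) hβ0 hβ2)
    (sub_nonneg.2 hβα) (sub_le_self 1 hβα0) (fun j x => lazyDiff_le (hμ s j) (hα s j) hβ0 hβ1 x)
    (by rw [Fintype.card_fin]; omega) (by norm_num)
    (fun w hw => by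
      have h2 : ε ≤ rho ψ (μ s) w := (mem_filter.1 hw).2.2.1
      have h3 : 0 < rho ψ (μ s) w := (Real.exp_pos _).trans_le h2
      positivity)
    (fun w hw => by
      obtain ⟨-, h2, h3, -, -⟩ := mem_filter.1 hw
      have h4 := two_pow_mul_rho_le (w := w) hψ (hμ s) (hα s) 16
      have h5 := herr w h2
      have h6 : 0 ≤ (Fintype.card F : ℝ)⁻¹ := by positivity
      have h7 := hpow
      norm_num at h4 ⊢
      norm_num at h5
      linarith [Real.exp_nonneg (-(α * n / 2 ^ 80))])
    (fun w hw i => by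
      obtain ⟨-, -, -, h3, h4⟩ := mem_filter.1 hw
      have h5 := pr_dotProduct_le (w := w) hψ (hμ (σ i))
      have h6 := h4 (σ i)
      norm_num
      linarith)
  rw [Fintype.card_fin] at h1
  refine (mul_le_mul_of_nonneg_left h1 (by positivity)).trans ?_
  rw [mul_comm ((k.choose (n / 4) : ℝ) * _), inv_mul_cancel_left₀ (by positivity)]
  have h2 : (k.choose (n / 4) : ℝ) ≤ 2 ^ n := by
    have h3 : k.choose (n / 4) ≤ 2 ^ n :=
      (Nat.choose_le_choose _ hk).trans (Nat.choose_le_two_pow n _)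
    exact_mod_cast h3
  have h3 : ((44 : ℝ) / 2 ^ 16) ^ (n / 4) ≤ (1 / 4) ^ n := by
    have h4 : (44 : ℝ) / 2 ^ 16 ≤ (1 / 4) ^ 5 := by norm_num
    refine (pow_le_pow_left₀ (by norm_num) h4 _).trans ?_
    rw [← pow_mul]
    exact pow_le_pow_of_le_one (by norm_num) (by norm_num) (by omega)
  refine (mul_le_mul h2 h3 (by positivity) (by positivity)).trans ?_
  rw [← mul_pow]
  have h6 : (2 : ℝ) * (1 / 4) ≤ Real.exp (-(1 / 2)) := by
    linarith [Real.one_sub_le_exp_neg (1 / 2)]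
  refine (pow_le_pow_left₀ (by norm_num) h6 _).trans ?_
  rw [← Real.exp_nat_mul, Real.exp_le_exp]
  linarith

theorem spanError_le_pow_mul_exp {μ : Fin n → Fin n → F → ℝ}
    (hμ : ∀ i j, IsProb (μ i j)) (hα : ∀ i j, BalancedWeight α (μ i j)) (hα0 : 0 < α)
    (hα1 : α ≤ 1) (hk : k ≤ n) (hn : 2 ^ 74 ≤ α * n) (σ : Fin k → Fin n) (i' : Fin n) :
    spanError (fun i => μ (σ i)) (μ i') ≤
      8 * (n : ℝ) ^ (2 * ⌈24576 / α⌉₊ + 1) * Real.exp (-(α * n / 2 ^ 80)) := by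
  have hn0 : (0 : ℝ) ≤ n := Nat.cast_nonneg n
  have hn1 : (1 : ℝ) ≤ n := by nlinarith
  set ε := Real.exp (-(α * n / 2 ^ 80)) with hε
  have hε0 : 0 < ε := Real.exp_pos _
  have hαn : α * n ≤ n := by nlinarith
  have hexp : ∀ x : ℝ, α * n / 2 ^ 80 ≤ x → Real.exp (-x) ≤ ε := fun x hx =>
    Real.exp_le_exp.2 (neg_le_neg hx)
  set N : ℝ := (n : ℝ) ^ (2 * ⌈24576 / α⌉₊)
  have hN1 : 1 ≤ N := one_le_pow₀ hn1
  have hNn : 1 ≤ n * N := by nlinarith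
  have hNn2 : (n : ℝ) ≤ n * N := by nlinarith
  have hgoal : 8 * (n : ℝ) ^ (2 * ⌈24576 / α⌉₊ + 1) * ε = 8 * (n * N) * ε := by
    rw [pow_succ]; ring
  rw [hgoal]
  have hαn0 : 0 ≤ α * n := by positivity
  by_cases hd : n ≤ 200 * (n - k)
  · refine (spanError_le_of_codim (fun i => hμ (σ i)) (hμ i') (hα i') hα0.le hα1 hd).trans ?_
    refine (hexp (α * n / 400) ?_).trans ?_
    · norm_num
      linarith
    · nlinarith
  · have hψ := AddChar.FiniteField.primitiveChar_to_Complex_isPrimitive F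
    have hd' : 200 * (n - k) < n := not_le.1 hd
    refine (spanError_le hψ hμ σ i' (n / 200) hε0.le).trans ?_
    have h1 := pr_sparseKernel_le hψ hμ hα hα0 hα1 hk hd' σ
    have h2 := sum_unstructured_le hψ hμ hα hα0 hα1 hk σ i'
    have h3 := sum_le_sum fun s (_ : s ∈ univ) =>
      sum_structured_le hψ hμ hα hα0 hα1 hk hd' hn σ s
    rw [← mul_sum, sum_const, card_univ, Fintype.card_fin, nsmul_eq_mul, ← hε] at h3
    rw [← hε] at h2
    rw [mul_add ((Fintype.card F : ℝ) ^ (n - k))⁻¹]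
    have e1 := hexp (α * n / 2) (by norm_num; linarith)
    have e2 := hexp (n / 10) (by norm_num; linarith)
    have e3 := hexp (n / 2) (by norm_num; linarith)
    have h4 : (n : ℝ) * (N * Real.exp (-(α * n / 2)) + Real.exp (-(n / 10))) ≤
        n * N * ε + n * ε := by
      have := mul_le_mul_of_nonneg_left e1 (by positivity : 0 ≤ n * N)
      have := mul_le_mul_of_nonneg_left e2 hn0
      linarith
    have h5 := mul_le_mul_of_nonneg_left e3 hn0
    have h6 : n * ε ≤ n * N * ε := mul_le_mul_of_nonneg_right hNn2 hε0.le
    have h7 : ε ≤ n * N * ε := by nlinarith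
    -- Sparse vectors cost `2 * (n * N * ε)`, the three other kinds `2 * (n * N * ε)` each: hence
    -- the factor `8`.
    have h8 : pr (prodWeight fun i => prodWeight (μ (σ i))) (SparseKernel (n / 200)) ≤
      2 * (n * N * ε) := by linarith
    nlinarith

end

/-! ### Multiplying the conditional probabilities, and the infinite product. -/

section

open scoped Classical
open Finset Matrix

variable {F : Type*} [Field F] [Fintype F] {n : ℕ} {α : ℝ}

theorem pr_prodWeight_succ_last {k : ℕ} {E : Type*} [Fintype E] (p : Fin (k + 1) → E → ℝ)
    (S : (Fin (k + 1) → E) → Prop) :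
    pr (prodWeight p) S =
      ∑ A, prodWeight (fun j : Fin k => p j.castSucc) A *
        pr (p (Fin.last k)) (fun x => S (Fin.snoc (α := fun _ => E) A x)) := by
  simp only [pr, mul_sum]
  rw [sum_comm, ← Fintype.sum_prod_type']
  refine (Fintype.sum_equiv (Fin.snocEquiv fun _ => E) _ _ fun x => ?_).symm
  have h : Fin.snocEquiv (fun _ => E) x = Fin.snoc (α := fun _ => E) x.2 x.1 := rfl
  simp only [h, prodWeight, Fin.prod_univ_castSucc, Fin.snoc_last, Fin.snoc_castSucc]
  ring

/-- The probability that the first `k` rows are linearly independent. -/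
noncomputable def indepProb (μ : Fin n → Fin n → F → ℝ) {k : ℕ} (hk : k ≤ n) : ℝ :=
  pr (prodWeight fun i : Fin k => prodWeight (μ (Fin.castLE hk i)))
    (fun A => LinearIndependent F A)

theorem indepProb_succ_sub {μ : Fin n → Fin n → F → ℝ} (hμ : ∀ i j, IsProb (μ i j)) {k : ℕ}
    (hk : k + 1 ≤ n) :
    |indepProb μ hk - indepProb μ (Nat.le_of_succ_le hk) *
        (1 - ((Fintype.card F : ℝ) ^ (n - k))⁻¹)| ≤
      spanError (fun i : Fin k => μ (Fin.castLE (Nat.le_of_succ_le hk) i))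
        (μ (Fin.castLE hk (Fin.last k))) := by
  have hW : IsProb (prodWeight fun i : Fin k =>
      prodWeight (μ (Fin.castLE (Nat.le_of_succ_le hk) i))) :=
    isProb_prodWeight fun i => isProb_prodWeight (hμ _)
  set W := prodWeight fun i : Fin k => prodWeight (μ (Fin.castLE (Nat.le_of_succ_le hk) i))
    with hWdef
  have hR := isProb_prodWeight (hμ (Fin.castLE hk (Fin.last k)))
  have h1 : indepProb μ hk = ∑ A, W A * (ind (LinearIndependent F A) *
      (1 - pr (prodWeight (μ (Fin.castLE hk (Fin.last k))))
        (fun x => x ∈ Submodule.span F (Set.range A)))) := by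
    rw [indepProb, pr_prodWeight_succ_last]
    refine sum_congr rfl fun A _ => ?_
    have hcast : ∀ j : Fin k, Fin.castLE hk j.castSucc = Fin.castLE (Nat.le_of_succ_le hk) j :=
      fun j => rfl
    simp only [hcast, ← hWdef]
    congr 1
    rw [← pr_true hR]
    simp only [pr_eq_sum_ind, ← sum_sub_distrib, mul_sum]
    refine sum_congr rfl fun x _ => ?_
    by_cases hA : LinearIndependent F A <;>
      by_cases hx : x ∈ Submodule.span F (Set.range A) <;>
      simp [ind, linearIndependent_finSnoc, hA, hx]
  have h2 : indepProb μ hk - indepProb μ (Nat.le_of_succ_le hk) *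
        (1 - ((Fintype.card F : ℝ) ^ (n - k))⁻¹) =
      ∑ A, W A * (ind (LinearIndependent F A) *
        (((Fintype.card F : ℝ) ^ (n - k))⁻¹ -
          pr (prodWeight (μ (Fin.castLE hk (Fin.last k))))
            (fun x => x ∈ Submodule.span F (Set.range A)))) := by
    rw [h1, indepProb, pr_eq_sum_ind, sum_mul, ← sum_sub_distrib]
    exact sum_congr rfl fun A _ => by ring
  rw [h2]
  refine (abs_sum_le_sum_abs _ _).trans_eq (sum_congr rfl fun A _ => ?_)
  rw [abs_mul, abs_mul, abs_of_nonneg (hW.nonneg A), abs_of_nonneg (ind_nonneg _), abs_sub_comm]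

/-- The factors lie in `[0, 1]`, so earlier errors are not amplified and each row adds at most `e`.
-/
theorem abs_indepProb_sub_prod_le {μ : Fin n → Fin n → F → ℝ} (hμ : ∀ i j, IsProb (μ i j)) {e : ℝ}
    (he : ∀ (k : ℕ) (σ : Fin k → Fin n) (i' : Fin n), k ≤ n →
      spanError (fun i => μ (σ i)) (μ i') ≤ e) {k : ℕ} (hk : k ≤ n) :
    |indepProb μ hk - ∏ i ∈ range k, (1 - ((Fintype.card F : ℝ) ^ (n - i))⁻¹)| ≤ k * e := by
  induction k with
  | zero =>
    have : indepProb μ hk = 1 := by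
      rw [indepProb, pr_congr (T := fun _ => True),
        pr_true (isProb_prodWeight fun i => isProb_prodWeight (hμ _))]
      intro A
      simp
    simp [this]
  | succ k ih =>
    have h1 := ih (Nat.le_of_succ_le hk)
    have h2 := (indepProb_succ_sub hμ hk).trans (he k _ _ (Nat.le_of_succ_le hk))
    rw [prod_range_succ]
    set a := indepProb μ (Nat.le_of_succ_le hk)
    set b := ∏ i ∈ range k, (1 - ((Fintype.card F : ℝ) ^ (n - i))⁻¹)
    set t := 1 - ((Fintype.card F : ℝ) ^ (n - k))⁻¹
    have ht0 : 0 ≤ t := sub_nonneg.2 (inv_card_pow_le_one _)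
    have ht1 : t ≤ 1 := by
      have : 0 ≤ ((Fintype.card F : ℝ) ^ (n - k))⁻¹ := by positivity
      linarith
    have h3 : |(a - b) * t| ≤ k * e := by
      rw [abs_mul, abs_of_nonneg ht0]
      exact (mul_le_of_le_one_right (abs_nonneg _) ht1).trans h1
    calc |indepProb μ hk - b * t| = |(indepProb μ hk - a * t) + (a - b) * t| := by ring_nf
      _ ≤ e + k * e := (abs_add_le _ _).trans (add_le_add h2 h3)
      _ = ((k + 1 : ℕ) : ℝ) * e := by push_cast; ring

theorem one_sub_sum_le_prod_one_sub {N : ℕ} {x : ℕ → ℝ} (h0 : ∀ i, 0 ≤ x i) (h1 : ∀ i, x i ≤ 1) :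
    1 - ∑ i ∈ range N, x i ≤ ∏ i ∈ range N, (1 - x i) := by
  induction N with
  | zero => simp
  | succ N ih =>
    rw [sum_range_succ, prod_range_succ]
    have h2 : ∏ i ∈ range N, (1 - x i) ≤ 1 :=
      prod_le_one (fun i _ => sub_nonneg.2 (h1 i)) fun i _ => sub_le_self 1 (h0 i)
    nlinarith [h0 N]

theorem tprod_one_sub_inv_pow_mem {q : ℕ} (hq : 2 ≤ q) (m : ℕ) :
    ∏' i : ℕ, (1 - ((q : ℝ) ^ (m + i))⁻¹) ∈ Set.Icc (1 - 2 * (1 / 2 : ℝ) ^ m) 1 := by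
  have hlim := (multipliable_one_sub_inv_pow hq m).hasProd.tendsto_prod_nat
  have hq1 : (1 : ℝ) ≤ q := by exact_mod_cast (by omega : 1 ≤ q)
  have h0 : ∀ i, 0 ≤ ((q : ℝ) ^ (m + i))⁻¹ := fun i => by positivity
  have h1 : ∀ i, ((q : ℝ) ^ (m + i))⁻¹ ≤ 1 := fun i => inv_le_one_of_one_le₀ (one_le_pow₀ hq1)
  refine ⟨ge_of_tendsto' hlim fun N => ?_, le_of_tendsto' hlim fun N => ?_⟩
  · refine le_trans ?_ (one_sub_sum_le_prod_one_sub h0 h1)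
    have h2 : ∀ i, ((q : ℝ) ^ (m + i))⁻¹ ≤ (1 / 2) ^ m * (1 / 2) ^ i := by
      intro i
      rw [← pow_add, ← inv_pow]
      refine pow_le_pow_left₀ (by positivity) ?_ _
      rw [one_div]
      exact inv_anti₀ (by norm_num) (by exact_mod_cast hq)
    have h3 : ∑ i ∈ range N, ((q : ℝ) ^ (m + i))⁻¹ ≤ (1 / 2) ^ m * 2 := by
      refine (sum_le_sum fun i _ => h2 i).trans ?_
      rw [← mul_sum]
      exact mul_le_mul_of_nonneg_left (sum_geometric_two_le N) (by positivity)
    linarith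
  · exact prod_le_one (fun i _ => sub_nonneg.2 (h1 i)) fun i _ => sub_le_self 1 (h0 i)

/-- The finite product is the first `k` factors of the infinite one, in reverse order. The remaining
tail starts at exponent `n + 1` and is within `2 * 2^{-(n+1)}` of `1`. -/
theorem abs_prod_sub_tprod_le {q : ℕ} (hq : 2 ≤ q) {k : ℕ} (hk : k ≤ n) :
    |∏ i ∈ range k, (1 - ((q : ℝ) ^ (n - i))⁻¹) -
        ∏' i : ℕ, (1 - ((q : ℝ) ^ (n - k + 1 + i))⁻¹)| ≤ (1 / 2) ^ n := by
  have hq1 : (1 : ℝ) ≤ q := by exact_mod_cast (by omega : 1 ≤ q)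
  have hsplit : ∏' i : ℕ, (1 - ((q : ℝ) ^ (n - k + 1 + i))⁻¹) =
      (∏ i ∈ range k, (1 - ((q : ℝ) ^ (n - i))⁻¹)) *
        ∏' i : ℕ, (1 - ((q : ℝ) ^ (n + 1 + i))⁻¹) := by
    have hshift : ∀ i, n - k + 1 + (i + k) = n + 1 + i := fun i => by omega
    have h1 := Multipliable.prod_mul_tprod_nat_mul' (k := k)
      (f := fun i : ℕ => (1 : ℝ) - ((q : ℝ) ^ (n - k + 1 + i))⁻¹)
      (by simp_rw [hshift]; exact multipliable_one_sub_inv_pow hq (n + 1))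
    simp_rw [hshift] at h1
    rw [← h1]
    congr 1
    rw [← prod_range_reflect]
    refine prod_congr rfl fun i hi => ?_
    have : n - k + 1 + (k - 1 - i) = n - i := by
      have := mem_range.1 hi
      omega
    rw [this]
  rw [hsplit]
  obtain ⟨h1, h2⟩ := tprod_one_sub_inv_pow_mem hq (n + 1)
  set b := ∏ i ∈ range k, (1 - ((q : ℝ) ^ (n - i))⁻¹)
  set t := ∏' i : ℕ, (1 - ((q : ℝ) ^ (n + 1 + i))⁻¹)
  have hx0 : ∀ i, 0 ≤ ((q : ℝ) ^ i)⁻¹ := fun i => by positivity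
  have hx1 : ∀ i, ((q : ℝ) ^ i)⁻¹ ≤ 1 := fun i => inv_le_one_of_one_le₀ (one_le_pow₀ hq1)
  have hb0 : 0 ≤ b := prod_nonneg fun i _ => sub_nonneg.2 (hx1 _)
  have hb1 : b ≤ 1 := prod_le_one (fun i _ => sub_nonneg.2 (hx1 _)) fun i _ => sub_le_self 1 (hx0 _)
  have h3 : b - b * t = b * (1 - t) := by ring
  rw [h3, abs_of_nonneg (mul_nonneg hb0 (by linarith))]
  refine (mul_le_of_le_one_left (by linarith) hb1).trans ?_
  rw [pow_succ] at h1
  linarith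

/-- The bound of the main theorem, for weights on a finite field. -/
theorem exists_abs_indepProb_sub_le (hα0 : 0 < α) :
    ∃ C : ℝ, 0 < C ∧ ∀ (F : Type*) [Field F] [Fintype F] (n : ℕ) (μ : Fin n → Fin n → F → ℝ),
      (∀ i j, IsProb (μ i j)) → (∀ i j, BalancedWeight α (μ i j)) → ∀ (k : ℕ) (hk : k ≤ n),
        |indepProb μ hk - ∏' i : ℕ, (1 - ((Fintype.card F : ℝ) ^ (n - k + 1 + i))⁻¹)| ≤
          C * Real.exp (-(1 / 2 ^ 81 * α * n)) := by
  -- The power of `n` is one more than in `spanError_le_pow_mul_exp`, since up to `n` errors are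
  -- added. The rate `b` is half of `α/2^80`: the other half absorbs `n^D`. The summand `exp 1` in
  -- `C` makes the claim trivial when `αn < 2^74`.
  set D := 2 * ⌈24576 / α⌉₊ + 2 with hD
  set b := 1 / 2 ^ 81 * α with hb
  have hb0 : 0 < b := by positivity
  set C := 9 * (D.factorial / b ^ D) + Real.exp 1
  have hC0 : 0 < C := by positivity
  refine ⟨C, hC0, fun F _ _ n μ hμ hα k hk => ?_⟩
  have hn0 : (0 : ℝ) ≤ n := Nat.cast_nonneg n
  have hq : 2 ≤ Fintype.card F := Fintype.one_lt_card
  by_cases hn : 2 ^ 74 ≤ α * n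
  · have hnpos : 0 < n := by
      rcases Nat.eq_zero_or_pos n with rfl | h
      · norm_num at hn
      · exact h
    have hn1 : (1 : ℝ) ≤ n := by exact_mod_cast hnpos
    -- A balanced probability weight can exist only for `α ≤ 1`; an entry is available because `n >
    -- 0`.
    have hα1 : α ≤ 1 := (hα ⟨0, hnpos⟩ ⟨0, hnpos⟩).le_one (hμ _ _)
    set E := 8 * (n : ℝ) ^ (2 * ⌈24576 / α⌉₊ + 1) * Real.exp (-(α * n / 2 ^ 80)) with hE
    have h1 := abs_indepProb_sub_prod_le (μ := μ) hμ (e := E)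
      (fun k σ i' hk => spanError_le_pow_mul_exp hμ hα hα0 hα1 hk hn σ i') hk
    have h2 := abs_prod_sub_tprod_le (n := n) hq hk
    have hE0 : 0 ≤ E := by positivity
    have hkn : (k : ℝ) * E ≤ n * E :=
      mul_le_mul_of_nonneg_right (by exact_mod_cast hk) hE0
    have h3 := (abs_sub_le _ _ _).trans (add_le_add (h1.trans hkn) h2)
    refine h3.trans ?_
    have hαn : α * n ≤ n := mul_le_of_le_one_left hn0 hα1
    have hαn0 : 0 ≤ α * n := by positivity
    have h4 : ((1 : ℝ) / 2) ^ n ≤ Real.exp (-(α * n / 2 ^ 80)) := by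
      have h5 : (1 : ℝ) / 2 ≤ Real.exp (-(1 / 2)) := by
        linarith [Real.one_sub_le_exp_neg (1 / 2)]
      refine (pow_le_pow_left₀ (by norm_num) h5 n).trans ?_
      rw [← Real.exp_nat_mul, Real.exp_le_exp]
      norm_num
      linarith
    have h5 : n * E = 8 * (n : ℝ) ^ D * Real.exp (-(α * n / 2 ^ 80)) := by
      rw [hE, hD]; ring
    have h6 : (1 : ℝ) ≤ (n : ℝ) ^ D := one_le_pow₀ hn1
    have h7 : n * E + (1 / 2) ^ n ≤ 9 * (n : ℝ) ^ D * Real.exp (-(α * n / 2 ^ 80)) := by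
      rw [h5]
      nlinarith [Real.exp_nonneg (-(α * n / 2 ^ 80))]
    refine h7.trans ?_
    have h8 : Real.exp (-(α * n / 2 ^ 80)) = Real.exp (-(b * n)) * Real.exp (-(b * n)) := by
      rw [← Real.exp_add]
      congr 1
      rw [hb]
      ring
    have h9 : (n : ℝ) ^ D ≤ D.factorial / b ^ D * Real.exp (b * n) := by
      have := Real.pow_div_factorial_le_exp (x := b * n) (by positivity) D
      rw [div_le_iff₀ (by positivity), mul_pow] at this
      rw [div_mul_eq_mul_div, le_div_iff₀ (by positivity)]
      linarith
    have h10 : (n : ℝ) ^ D * Real.exp (-(b * n)) ≤ D.factorial / b ^ D := by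
      rw [Real.exp_neg, ← div_eq_mul_inv, div_le_iff₀ (Real.exp_pos _)]
      exact h9
    rw [h8]
    calc 9 * (n : ℝ) ^ D * (Real.exp (-(b * n)) * Real.exp (-(b * n)))
        = 9 * ((n : ℝ) ^ D * Real.exp (-(b * n))) * Real.exp (-(b * n)) := by ring
      _ ≤ C * Real.exp (-(b * n)) := by
        refine mul_le_mul_of_nonneg_right ?_ (Real.exp_nonneg _)
        linarith [Real.exp_nonneg 1]
  · have h1 : 0 ≤ indepProb μ hk :=
      pr_nonneg (isProb_prodWeight fun i => isProb_prodWeight (hμ _)).nonneg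
    have h2 : indepProb μ hk ≤ 1 :=
      pr_le_one (isProb_prodWeight fun i => isProb_prodWeight (hμ _))
    obtain ⟨h3, h4⟩ := tprod_one_sub_inv_pow_mem hq (n - k + 1)
    have h5 : 2 * (1 / 2 : ℝ) ^ (n - k + 1) ≤ 1 := by
      have : (1 / 2 : ℝ) ^ (n - k) ≤ 1 := pow_le_one₀ (by norm_num) (by norm_num)
      rw [pow_succ]
      linarith
    have h6 : |indepProb μ hk - ∏' i : ℕ, (1 - ((Fintype.card F : ℝ) ^ (n - k + 1 + i))⁻¹)| ≤ 1 := by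
      rw [abs_le]
      constructor <;> linarith
    refine h6.trans ?_
    have h7 : Real.exp 1 * Real.exp (-(b * n)) ≤ C * Real.exp (-(b * n)) := by
      refine mul_le_mul_of_nonneg_right ?_ (Real.exp_nonneg _)
      have : 0 ≤ 9 * (D.factorial / b ^ D) := by positivity
      linarith
    refine le_trans ?_ h7
    rw [← Real.exp_add]
    refine Real.one_le_exp ?_
    have h8 : b * n = α * n / 2 ^ 81 := by rw [hb]; ring
    rw [h8]
    have h9 := (not_le.1 hn).le
    have h10 : α * n / 2 ^ 81 ≤ 1 := by
      rw [div_le_one (by positivity)]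
      exact h9.trans (by norm_num)
    linarith

end

/-! ### From random matrices to weights on finite sets. -/

section

open scoped Classical
open Finset

theorem finrank_rowSpace_eq_iff {F : Type*} [Field F] {n k : ℕ} (A : Matrix (Fin k) (Fin n) F) :
    Module.finrank F (rowSpace A) = k ↔ LinearIndependent F A.row := by
  rw [linearIndependent_iff_card_eq_finrank_span, Fintype.card_fin, eq_comm]
  rfl

section Transfer

variable {F : Type*} [Field F] [Fintype F] [MeasurableSpace F] [MeasurableSingletonClass F]
  {n : ℕ}

theorem isProb_real_singleton {E : Type*} [Fintype E] [MeasurableSpace E]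
    [MeasurableSingletonClass E] (μ : Measure E) [IsProbabilityMeasure μ] :
    IsProb fun x => μ.real {x} where
  nonneg _ := measureReal_nonneg
  sum_eq := by rw [sum_measureReal_singleton, coe_univ, probReal_univ]

theorem pr_real_singleton {E : Type*} [Fintype E] [MeasurableSpace E]
    [MeasurableSingletonClass E] (μ : Measure E) [IsProbabilityMeasure μ] (S : E → Prop) :
    pr (fun x => μ.real {x}) S = μ.real {x | S x} := by
  rw [sum_fiber_mul_eq_pr, sum_measureReal_singleton, coe_filter_univ]

theorem IsBalanced.balancedWeight {α : ℝ} {μ : Measure F} [IsProbabilityMeasure μ]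
    (h : IsBalanced α μ) : BalancedWeight α fun x => μ.real {x} := by
  intro x H hH
  rw [pr_real_singleton]
  refine le_trans (le_of_eq ?_) (h x H hH)
  congr 1
  ext y
  rw [Set.mem_vadd_set_iff_neg_vadd_mem, vadd_eq_add, neg_add_eq_sub]
  rfl

/-- Independence makes the joint law of the first `k` rows a product measure on a finite set, hence
determined by singletons; currying regroups the entries into rows. -/
theorem real_finrank_rowSpace_eq_indepProb {μ : Fin n → Fin n → Measure F}
    [∀ i j, IsProbabilityMeasure (μ i j)] {Ω : Type*} [MeasurableSpace Ω] {P : Measure Ω}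
    [IsProbabilityMeasure P] {M : Ω → Matrix (Fin n) (Fin n) F}
    (hM : ∀ i j, HasLaw (fun ω => M ω i j) (μ i j) P)
    (hind : iIndepFun (fun (ij : Fin n × Fin n) (ω : Ω) => M ω ij.1 ij.2) P) {k : ℕ}
    (hk : k ≤ n) :
    P.real {ω | Module.finrank F (rowSpace (topRows hk (M ω))) = k} =
      indepProb (fun i j x => (μ i j).real {x}) hk := by
  have hg : Function.Injective
      fun ij : Fin k × Fin n => ((Fin.castLE hk ij.1, ij.2) : Fin n × Fin n) := by
    rintro ⟨a, b⟩ ⟨c, d⟩ h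
    simpa using h
  have hX : ∀ ij : Fin k × Fin n,
      AEMeasurable (fun ω => M ω (Fin.castLE hk ij.1) ij.2) P := fun ij => (hM _ _).aemeasurable
  have hmap := (hind.precomp hg).map_fun_eq_pi_map hX
  simp only [(hM _ _).map_eq] at hmap
  set X : Ω → Fin k × Fin n → F := fun ω ij => M ω (Fin.castLE hk ij.1) ij.2
  have hXm : AEMeasurable X P := aemeasurable_pi_iff.2 hX
  set S : (Fin k × Fin n → F) → Prop := fun x => LinearIndependent F fun i j => x (i, j)
  have h1 : {ω | Module.finrank F (rowSpace (topRows hk (M ω))) = k} = X ⁻¹' {x | S x} := by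
    ext ω
    exact finrank_rowSpace_eq_iff _
  rw [h1, ← map_measureReal_apply_of_aemeasurable hXm (Set.toFinite _).measurableSet, hmap,
    ← pr_real_singleton]
  unfold indepProb pr
  refine Fintype.sum_equiv (Equiv.curry _ _ _) _ _ fun x => ?_
  congr 1
  beta_reduce
  rw [measureReal_def, Measure.pi_singleton, ENNReal.toReal_prod, Fintype.prod_prod_type]
  rfl

end Transfer

end

theorem mainTheorem7 :
    ∃ c : ℝ, 0 < c ∧ ∀ α : ℝ, 0 < α → ∃ C : ℝ, 0 < C ∧
      ∀ (F : Type*) [Field F] [Fintype F] [MeasurableSpace F] [MeasurableSingletonClass F]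
        (n : ℕ) (μ : Fin n → Fin n → Measure F) [∀ i j, IsProbabilityMeasure (μ i j)],
        (∀ i j, IsBalanced α (μ i j)) →
        ∀ (Ω : Type*) [MeasurableSpace Ω] (P : Measure Ω) [IsProbabilityMeasure P]
          (M : Ω → Matrix (Fin n) (Fin n) F),
          (∀ i j, HasLaw (fun ω => M ω i j) (μ i j) P) →
          iIndepFun (fun (ij : Fin n × Fin n) (ω : Ω) => M ω ij.1 ij.2) P →
          ∀ (k : ℕ) (hk : k ≤ n),
            |P.real {ω | Module.finrank F (rowSpace (topRows hk (M ω))) = k} -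
                ∏' i : ℕ, (1 - ((Fintype.card F : ℝ) ^ (n - k + 1 + i))⁻¹)| ≤
              C * Real.exp (-(c * α * n)) := by
  refine ⟨1 / 2 ^ 81, by positivity, fun α hα => ?_⟩
  obtain ⟨C, hC, h⟩ := exists_abs_indepProb_sub_le hα
  refine ⟨C, hC, fun F _ _ _ _ n μ _ hμ Ω _ P _ M hM hind k hk => ?_⟩
  rw [real_finrank_rowSpace_eq_indepProb hM hind hk]
  exact h F n _ (fun i j => isProb_real_singleton (μ i j)) (fun i j => (hμ i j).balancedWeight) k hk
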